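/- Let $\mathbb F_q$ be a finite field with $q$ elements, let $m\ge 1$, let $\lambda$ be a positive divisor of $q-1$, and put $n=\lambda(q^m+1)$. Write $m=2^v m_0$ with $v\ge 0$ and $m_0$ odd. A linear code of length $n$ over $\mathbb F_q$ is a subspace $C\subseteq\mathbb F_q^n$. It is cyclic if $(c_0,\dots,c_{n-1})\in C$ implies $(c_{n-1},c_0,\dots,c_{n-2})\in C$, and LCD if $C\cap C^\perp=\{0\}$, where $C^\perp$ is the dual for the standard inner product. For $\gamma\in\mathbb Z/n\mathbb Z$ let $C_\gamma=\{\gamma q^t : t\ge 0\}\subseteq\mathbb Z/n\mathbb Z$ be its $q$-cyclotomic coset, let $\mathrm{Ld}(\gamma)$ be the smallest element of $C_\gamma$ when its elements are viewed as integers in $\{0,\dots,n-1\}$, let $\Gamma$ be the set of all these coset leaders, and put $$\Pi=\Gamma\setminus\{\max\{\gamma,\mathrm{Ld}(n-\gamma)\} : \gamma\in\Gamma,\ n-\gamma\notin C_\gamma\}.$$ Then the number of nonzero LCD cyclic codes of length $n$ over $\mathbb F_q$ is $2^{|\Pi|}-1$, and, with $\mu$ the Möbius function, $|\Pi|$ is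 given as follows. (1) Suppose $\gcd(2,\frac{q-1}{\lambda})=1$. (1.1) If $q$ and $m$ are odd, then $$|\Pi|=\frac{\lambda(q+2)+q+3}{4}+\sum_{1<\tau_0\mid m}\frac{\lambda+1}{4\tau_0}\sum_{\epsilon\mid\tau_0}\mu(\epsilon)\,q^{\tau_0/\epsilon}.$$ (1.2) If $q$ is odd and $m$ is even, then $$|\Pi|=A+\frac{\lambda+1}{2^{v+2}}\left(q^{2^v}-1\right)+\sum_{1<\tau_0\mid m_0}\frac{\lambda+1}{2^{v+2}\tau_0}\sum_{\epsilon\mid\tau_0}\mu(\epsilon)\,q^{2^v\tau_0/\epsilon},$$ where $A=\frac{3\lambda+4}{4}$ if $q\equiv1\pmod 4$ and $A=\frac{3(\lambda+2)}{4}$ if $q\equiv 3\pmod 4$. (2) Suppose $\gcd(2,\frac{q-1}{\lambda})=2$. (2.1) If $q$ and $m$ are odd, then $$|\Pi|=\frac{(\lambda+1)(q+3)}{4}+\sum_{1<\tau_0\mid m}\frac{\lambda+1}{4\tau_0}\sum_{\epsilon\mid\tau_0}\mu(\epsilon)\,q^{\tau_0/\epsilon}.$$ (2.2) If $q$ is odd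 and $m$ is even, then $$|\Pi|=\lambda+1+\frac{\lambda+1}{2^{v+2}}\left(q^{2^v}-1\right)+\sum_{1<\tau_0\mid m_0}\frac{\lambda+1}{2^{v+2}\tau_0}\sum_{\epsilon\mid\tau_0}\mu(\epsilon)\,q^{2^v\tau_0/\epsilon}.$$ (3) If $q$ is even, then $$|\Pi|=\frac{\lambda+1}{2}+\sum_{\tau_0\mid m_0}\frac{\lambda+1}{2^{v+2}\tau_0}\sum_{\epsilon\mid\tau_0}\mu(\epsilon)\,q^{2^v\tau_0/\epsilon}.$$ -/

import Mathlib

/-- The `q`-cyclotomic coset `{γ, γ q, γ q ^ 2, …}` modulo `n` containing `γ`. -/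
def cyclotomicCoset (q n : ℕ) (γ : ZMod n) : Set (ZMod n) :=
  {x | ∃ t : ℕ, x = γ * (q : ZMod n) ^ t}

/-- The coset leader `Ld(γ)`: the least representative in `{0, …, n - 1}` of the elements of
the `q`-cyclotomic coset of `γ` modulo `n` (meaningful for `0 < n`). -/
noncomputable def cosetLeader (q n : ℕ) (γ : ZMod n) : ℕ :=
  sInf (ZMod.val '' cyclotomicCoset q n γ)

/-- The set `Γ` of all coset leaders of `q`-cyclotomic cosets modulo `n`. -/
def cosetLeaders (q n : ℕ) : Set ℕ :=
  Set.range (cosetLeader q n)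

/-- The set `Π = Γ \ {max {γ, Ld(n - γ)} | γ ∈ Γ, n - γ ∉ C_γ}`. -/
def leaderSetPi (q n : ℕ) : Set ℕ :=
  cosetLeaders q n \
    {k | ∃ γ ∈ cosetLeaders q n,
      ((n - γ : ℕ) : ZMod n) ∉ cyclotomicCoset q n (γ : ZMod n) ∧
      k = max γ (cosetLeader q n ((n - γ : ℕ) : ZMod n))}

/-- A linear code `C ⊆ F ^ n` is cyclic if it is closed under the cyclic shift
`(c₀, c₁, …, cₙ₋₁) ↦ (cₙ₋₁, c₀, …, cₙ₋₂)`. -/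
def IsCyclicCode {F : Type*} [Field F] {n : ℕ} (C : Submodule F (Fin n → F)) : Prop :=
  ∀ c ∈ C, (fun i => c ((finRotate n).symm i)) ∈ C

/-- The dual of a linear code with respect to the standard inner product. -/
def dualCode {F : Type*} [Field F] {n : ℕ} (C : Submodule F (Fin n → F)) :
    Submodule F (Fin n → F) where
  carrier := {x | ∀ c ∈ C, x ⬝ᵥ c = 0}
  zero_mem' := fun c _ => zero_dotProduct c
  add_mem' := fun {x y} hx hy c hc => by
    rw [add_dotProduct, hx c hc, hy c hc, add_zero]
  smul_mem' := fun a x hx c hc => by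
    rw [smul_dotProduct, hx c hc, smul_zero]

/-- A linear code is LCD (linear complementary dual) if it meets its dual only in `0`. -/
def IsLCDCode {F : Type*} [Field F] {n : ℕ} (C : Submodule F (Fin n → F)) : Prop :=
  C ⊓ dualCode C = ⊥

/-- The set of (nonzero) LCD cyclic codes of length `n` over `F`. -/
def lcdCyclicCodes (F : Type*) [Field F] (n : ℕ) : Set (Submodule F (Fin n → F)) :=
  {C | C ≠ ⊥ ∧ IsCyclicCode C ∧ IsLCDCode C}

/-- The Möbius sum `∑_{ε ∣ τ} μ(ε) q ^ (s τ / ε)`. -/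
def moebiusSum (q s τ : ℕ) : ℚ :=
  ∑ ε ∈ τ.divisors, (ArithmeticFunction.moebius ε : ℚ) * (q : ℚ) ^ (s * τ / ε)

section

open Finset AddMonoidAlgebra

/-! Words of length `n` are identified with elements of the group algebra of `ZMod n`; cyclic codes
become ideals and the inner product becomes the coefficient at `0` of `x * y*`, where `*` is induced
by negation. Since `q ^ (2 * m) = 1` modulo `n`, every element satisfies `a ^ (q ^ (2 * m)) = a`, so
every ideal is generated by a unique idempotent `e`, and the code is LCD exactly when `e* = e`
(`isLCDCode_cyclicCodeOf_iff`). Such `e` are the idempotents of the subalgebra fixed by Frobenius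
and `*`. It consists of the functions constant on the classes `C_γ ∪ C_{-γ}`, and `a ^ q = a` holds
in it, so it is a product of `r` fields of order `q`, with `r` the number of classes; this gives `2
^ r` idempotents. By `leaderSetPi_eq_range` and `ncard_leaderSetPi`, `r = |Π|`.

Burnside's lemma for multiplication by powers of `q` and by `±1` (`card_signedCosetSetoid`) gives `4
m r = ∑ (gcd(q^k - 1, n) + gcd(q^k + 1, n))` over `k < 2m`. The first gcd is large only if `2 ^ (v +
1) ∣ k`, the second only if `k` has exactly `v` factors `2`; all others depend only on parities and
residues modulo `4`. The large terms are powers of `q ^ 2 ^ v` with exponents `gcd(j, m₀)`, which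
Möbius inversion turns into the divisor sums. -/

/-! ### Evaluation of gcd(q^k ± 1, λ(q^m + 1)) -/

/-- The cofactor is an alternating sum of an odd number of powers of `P`, hence `1` modulo `P - 1`.
Writing it as `1 + (P - 1) * W` makes its coprimality to every divisor of `P - 1`, in particular to
`lam`, immediate. -/
theorem exists_pow_add_one_eq {P i : ℕ} (hP : 1 ≤ P) (hi : Odd i) :
    ∃ W, P ^ i + 1 = (P + 1) * (1 + (P - 1) * W) := by
  obtain ⟨s, rfl⟩ := hi
  obtain ⟨c, rfl⟩ := Nat.exists_eq_add_of_le hP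
  induction s with
  | zero => exact ⟨0, by simp⟩
  | succ s ih =>
    obtain ⟨W, hW⟩ := ih
    simp only [Nat.add_sub_cancel_left] at hW ⊢
    refine ⟨W + (1 + c) ^ (2 * s + 1), ?_⟩
    have h : (1 + c) ^ (2 * (s + 1) + 1) = (1 + c) ^ (2 * s + 1) * (1 + c) ^ 2 := by ring
    rw [h]
    zify at hW ⊢
    linear_combination hW

theorem exists_pow_two_mul_sub_one_eq (P i : ℕ) :
    ∃ X, P ^ (2 * i) - 1 = (P ^ 2 - 1) * X := by
  have := Nat.sub_dvd_pow_sub_pow (P ^ 2) 1 i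
  rw [one_pow, ← pow_mul] at this
  exact this

theorem coprime_of_pow_sub_one_eq {P a b X Y : ℕ} (hP : 2 ≤ P) (hab : a.Coprime b)
    (hX : P ^ (2 * a) - 1 = (P ^ 2 - 1) * X) (hY : P ^ (2 * b) - 1 = (P ^ 2 - 1) * Y) :
    X.Coprime Y := by
  have h := Nat.pow_sub_one_gcd_pow_sub_one (P ^ 2) a b
  rw [hab, ← pow_mul, ← pow_mul, hX, hY, Nat.gcd_mul_left, pow_one] at h
  have hpos : 0 < P ^ 2 - 1 := Nat.sub_pos_of_lt (Nat.one_lt_pow (by norm_num) (by lia))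
  exact Nat.eq_of_mul_eq_mul_left hpos (by rw [h, mul_one])

theorem pow_two_mul_sub_one (P i : ℕ) : P ^ (2 * i) - 1 = (P ^ i + 1) * (P ^ i - 1) := by
  rw [mul_comm 2 i, pow_mul, ← Nat.sq_sub_sq, one_pow]

theorem exists_geom {P i Y : ℕ} (h : P ^ i + 1 = (P + 1) * Y) :
    ∃ Z, P ^ (2 * i) - 1 = (P ^ 2 - 1) * (Y * Z) := by
  obtain ⟨Z, hZ⟩ := Nat.sub_dvd_pow_sub_pow P 1 i
  rw [one_pow] at hZ
  refine ⟨Z, ?_⟩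
  have := pow_two_mul_sub_one P 1
  rw [mul_one, pow_one] at this
  rw [pow_two_mul_sub_one, h, hZ, this]
  ring

/-- After dividing out `lam * (P + 1)`, the left side is `w * X` with `w ∣ P - 1`, and the right
side is a cofactor that is `1` modulo `P - 1` and divides the analogue of `X` for `b`; both factors
are therefore coprime to it. -/
theorem gcd_pow_sub_one_mul_pow_add_one_aux {P lam a b : ℕ} (hP : 2 ≤ P) (hlam : lam ∣ P - 1)
    (hab : a.Coprime b) (hb : Odd b) :
    Nat.gcd (P ^ (2 * a) - 1) (lam * (P ^ b + 1)) = lam * (P + 1) := by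
  obtain ⟨W, hW⟩ := exists_pow_add_one_eq (by lia : 1 ≤ P) hb
  obtain ⟨X, hX⟩ := exists_pow_two_mul_sub_one_eq P a
  obtain ⟨Z, hZ⟩ := exists_geom hW
  have hc := (coprime_of_pow_sub_one_eq hP hab hX hZ).coprime_mul_right_right
  obtain ⟨w, hw⟩ := hlam
  have h2 : P ^ 2 - 1 = (P + 1) * (P - 1) := by
    simpa using pow_two_mul_sub_one P 1
  have hc2 : w.Coprime (1 + (P - 1) * W) := by
    rw [hw, mul_comm lam w, mul_assoc]
    simp
  have e1 : P ^ (2 * a) - 1 = lam * (P + 1) * (w * X) := by rw [hX, h2, hw]; ring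
  rw [e1, hW, ← mul_assoc lam (P + 1), Nat.gcd_mul_left, (hc2.mul_left hc : Nat.gcd _ _ = 1), mul_one]

theorem gcd_pow_add_one_mul_pow_add_one_aux {P lam a b : ℕ} (hP : 2 ≤ P) (hlam : lam ∣ P - 1)
    (hab : a.Coprime b) (ha : Odd a) (hb : Odd b) :
    Nat.gcd (P ^ a + 1) (lam * (P ^ b + 1)) = P + 1 := by
  obtain ⟨V, hV⟩ := exists_pow_add_one_eq (by lia : 1 ≤ P) ha
  obtain ⟨W, hW⟩ := exists_pow_add_one_eq (by lia : 1 ≤ P) hb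
  obtain ⟨X, hX⟩ := exists_geom hV
  obtain ⟨Z, hZ⟩ := exists_geom hW
  have hc := (coprime_of_pow_sub_one_eq hP hab hX hZ).coprime_mul_right_right.coprime_mul_right
  have hc2 : (1 + (P - 1) * V).Coprime lam := by
    obtain ⟨w, hw⟩ := hlam
    rw [hw, mul_assoc]
    simp
  rw [hV, hW, mul_left_comm, Nat.gcd_mul_left, (hc2.mul_right hc : Nat.gcd _ _ = 1), mul_one]

theorem dvd_pow_sub_one_of_dvd_sub_one {q lam : ℕ} (hlam : lam ∣ q - 1) (d : ℕ) : lam ∣ q ^ d - 1 := by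
  have := Nat.sub_dvd_pow_sub_pow q 1 d
  rw [one_pow] at this
  exact hlam.trans this

/-- The case of an exponent `k` with more factors `2` than `m`. -/
theorem gcd_pow_sub_one_mul_pow_add_one {q lam j v m₀ : ℕ} (hq : 2 ≤ q) (hlam : lam ∣ q - 1)
    (hm₀ : Odd m₀) :
    Nat.gcd (q ^ (2 ^ (v + 1) * j) - 1) (lam * (q ^ (2 ^ v * m₀) + 1)) =
      lam * ((q ^ 2 ^ v) ^ Nat.gcd j m₀ + 1) := by
  have hg : 0 < Nat.gcd j m₀ := Nat.gcd_pos_of_pos_right _ hm₀.pos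
  obtain ⟨a, b, hab, ha, hb⟩ := Nat.exists_coprime j m₀
  set g := Nat.gcd j m₀ with hgdef
  have hP : 2 ≤ (q ^ 2 ^ v) ^ g := by
    rw [← pow_mul]
    exact hq.trans (Nat.le_self_pow (by positivity) q)
  have hlam' : lam ∣ (q ^ 2 ^ v) ^ g - 1 := by
    rw [← pow_mul]; exact dvd_pow_sub_one_of_dvd_sub_one hlam _
  have hbo : Odd b := by rw [hb] at hm₀; exact (Nat.odd_mul.mp hm₀).1
  rw [← gcd_pow_sub_one_mul_pow_add_one_aux hP hlam' hab hbo]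
  congr 2
  · rw [← pow_mul, ← pow_mul, ha]; congr 1; ring_nf
  · rw [← pow_mul, ← pow_mul, hb]; ring_nf

/-- With `P = (q ^ 2 ^ v) ^ gcd(i, m₀)` the remaining exponents are odd and coprime. The factor
`lam` contributes nothing here, being coprime to the cofactor of `P + 1`. -/
theorem gcd_pow_add_one_mul_pow_add_one {q lam i v m₀ : ℕ} (hq : 2 ≤ q) (hlam : lam ∣ q - 1)
    (hi : Odd i) (hm₀ : Odd m₀) :
    Nat.gcd (q ^ (2 ^ v * i) + 1) (lam * (q ^ (2 ^ v * m₀) + 1)) =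
      (q ^ 2 ^ v) ^ Nat.gcd i m₀ + 1 := by
  have hg : 0 < Nat.gcd i m₀ := Nat.gcd_pos_of_pos_right _ hm₀.pos
  obtain ⟨a, b, hab, ha, hb⟩ := Nat.exists_coprime i m₀
  set g := Nat.gcd i m₀ with hgdef
  have hP : 2 ≤ (q ^ 2 ^ v) ^ g := by
    rw [← pow_mul]
    exact hq.trans (Nat.le_self_pow (by positivity) q)
  have hlam' : lam ∣ (q ^ 2 ^ v) ^ g - 1 := by
    rw [← pow_mul]; exact dvd_pow_sub_one_of_dvd_sub_one hlam _
  have hao : Odd a := by rw [ha] at hi; exact (Nat.odd_mul.mp hi).1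
  have hbo : Odd b := by rw [hb] at hm₀; exact (Nat.odd_mul.mp hm₀).1
  rw [← gcd_pow_add_one_mul_pow_add_one_aux hP hlam' hab hao hbo]
  congr 2
  · rw [← pow_mul, ← pow_mul, ha]; ring_nf
  · rw [← pow_mul, ← pow_mul, hb]; ring_nf

/-- If `1` and `-1` are powers of `x` and `y` that agree in `ZMod D`, then `D ∣ 2`. -/
theorem dvd_two_of_pow_eq {D : ℕ} {x y : ZMod D} {a b : ℕ} (h : x ^ a = y ^ b)
    (hx : x ^ a = 1) (hy : y ^ b = -1) : D ∣ 2 := by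
  have : (2 : ZMod D) = 0 := by
    have : (1 : ZMod D) = -1 := hx.symm.trans (h.trans hy)
    linear_combination this
  rw [← ZMod.natCast_eq_zero_iff]
  exact_mod_cast this

theorem natCast_pow_eq_one_of_dvd {D q k : ℕ} (hq : 0 < q) (h : D ∣ q ^ k - 1) :
    (q : ZMod D) ^ k = 1 := by
  rw [← ZMod.natCast_eq_zero_iff, Nat.cast_sub (Nat.one_le_pow _ _ hq)] at h
  push_cast at h
  exact sub_eq_zero.mp h

theorem natCast_pow_eq_neg_one_of_dvd {D q k : ℕ} (h : D ∣ q ^ k + 1) :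
    (q : ZMod D) ^ k = -1 := by
  rw [← ZMod.natCast_eq_zero_iff] at h
  push_cast at h
  exact eq_neg_of_add_eq_zero_left h

theorem exists_odd_mul_of_not_dvd {k v : ℕ} (hk : ¬ 2 ^ (v + 1) ∣ k) :
    ∃ u i, u ≤ v ∧ Odd i ∧ k = 2 ^ u * i := by
  have hk0 : k ≠ 0 := by rintro rfl; simp at hk
  obtain ⟨u, i, hi, rfl⟩ := Nat.exists_eq_two_pow_mul_odd hk0
  refine ⟨u, i, ?_, hi, rfl⟩
  by_contra! h
  exact hk ((pow_dvd_pow 2 h).mul_right i)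

/-- With `k = 2 ^ u * i`, `u ≤ v`, `i` odd, the power `q ^ (2 ^ v * m₀ * i)` is `1` as a power of `q
^ k`, and `(-1) ^ i = -1` by the other divisibility. -/
theorem dvd_two_of_dvd_pow_sub_one {D q k v m₀ : ℕ} (hq : 0 < q)
    (hk : ¬ 2 ^ (v + 1) ∣ k) (h1 : D ∣ q ^ k - 1) (h2 : D ∣ q ^ (2 ^ v * m₀) + 1) : D ∣ 2 := by
  obtain ⟨u, i, hu, hi, rfl⟩ := exists_odd_mul_of_not_dvd hk
  have e1 := natCast_pow_eq_one_of_dvd hq h1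
  have e2 := natCast_pow_eq_neg_one_of_dvd h2
  obtain ⟨w, rfl⟩ := Nat.exists_eq_add_of_le hu
  refine dvd_two_of_pow_eq (a := 2 ^ w * m₀) (b := i) ?_ ?_ ?_ (x := (q : ZMod D) ^ (2 ^ u * i))
    (y := (q : ZMod D) ^ (2 ^ (u + w) * m₀))
  · rw [← pow_mul, ← pow_mul]; ring_nf
  · rw [e1, one_pow]
  · rw [e2, hi.neg_one_pow]

/-- The two exponents at which `q` becomes `-1` have different 2-adic valuations, so a common
multiple of them is an even multiple of one and an odd multiple of the other. -/
theorem dvd_two_of_dvd_pow_add_one {D q k v m₀ : ℕ} (hm₀ : Odd m₀)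
    (hk : ¬ (2 ^ v ∣ k ∧ ¬ 2 ^ (v + 1) ∣ k)) (h1 : D ∣ q ^ k + 1)
    (h2 : D ∣ q ^ (2 ^ v * m₀) + 1) : D ∣ 2 := by
  have e1 := natCast_pow_eq_neg_one_of_dvd h1
  have e2 := natCast_pow_eq_neg_one_of_dvd h2
  by_cases hd : 2 ^ (v + 1) ∣ k
  · obtain ⟨j, rfl⟩ := hd
    refine dvd_two_of_pow_eq (a := 2 * j) (b := m₀) ?_ ?_ ?_
      (y := (q : ZMod D) ^ (2 ^ (v + 1) * j)) (x := (q : ZMod D) ^ (2 ^ v * m₀))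
    · rw [← pow_mul, ← pow_mul]; ring_nf
    · rw [e2, pow_mul, neg_one_sq, one_pow]
    · rw [e1, hm₀.neg_one_pow]
  · obtain ⟨u, i, hu, hi, rfl⟩ := exists_odd_mul_of_not_dvd hd
    have hne : u ≠ v := by
      rintro rfl
      exact hk ⟨dvd_mul_right _ _, hd⟩
    obtain ⟨w, rfl⟩ := Nat.exists_eq_add_of_le (Nat.lt_of_le_of_ne hu hne)
    refine dvd_two_of_pow_eq (a := 2 ^ (w + 1) * m₀) (b := i) ?_ ?_ ?_
      (x := (q : ZMod D) ^ (2 ^ u * i)) (y := (q : ZMod D) ^ (2 ^ (u + 1 + w) * m₀))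
    · rw [← pow_mul, ← pow_mul]; ring_nf
    · rw [e1, Even.neg_one_pow]
      exact (even_two.pow_of_ne_zero (by lia)).mul_right _
    · rw [e2, hi.neg_one_pow]

theorem eq_ite_of_gcd_dvd_two {e M : ℕ} (h : Nat.gcd e M ∣ 2) :
    Nat.gcd e M = if 2 ∣ e ∧ 2 ∣ M then 2 else 1 := by
  split_ifs with h2
  · exact Nat.dvd_antisymm h (Nat.dvd_gcd h2.1 h2.2)
  · rcases (Nat.dvd_prime Nat.prime_two).mp h with h1 | h1
    · exact h1
    · exact absurd (Nat.dvd_gcd_iff.mp h1.symm.dvd) h2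

/-- Once `lam` is pulled out, any common divisor of the remaining factors divides both `q ^ k - 1`
and `q ^ m + 1`, hence `2`; only parities are left to decide. -/
theorem gcd_pow_sub_one_eq_ite {q lam k v m₀ : ℕ} (hq : 2 ≤ q) (hlam : lam ∣ q - 1)
    (hk : ¬ 2 ^ (v + 1) ∣ k) :
    Nat.gcd (q ^ k - 1) (lam * (q ^ (2 ^ v * m₀) + 1)) =
      if 2 ∣ (q ^ k - 1) / lam ∧ Odd q then 2 * lam else lam := by
  have hlam0 : 0 < lam := Nat.pos_of_dvd_of_pos hlam (by lia)
  obtain ⟨e, he⟩ := dvd_pow_sub_one_of_dvd_sub_one hlam k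
  have hd : Nat.gcd e (q ^ (2 ^ v * m₀) + 1) ∣ 2 := by
    refine dvd_two_of_dvd_pow_sub_one (by lia) hk ?_ (Nat.gcd_dvd_right _ _)
    rw [he]
    exact (Nat.gcd_dvd_left _ _).mul_left _
  have hk0 : k ≠ 0 := by rintro rfl; simp at hk
  rw [he, Nat.gcd_mul_left, eq_ite_of_gcd_dvd_two hd, Nat.mul_div_cancel_left _ hlam0]
  by_cases h2 : 2 ∣ e
  · have h3 : 2 ∣ q ^ (2 ^ v * m₀) + 1 ↔ Odd q := by
      constructor
      · intro h
        have h1 : 2 ∣ q ^ k - 1 := by rw [he]; exact h2.mul_left _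
        by_contra hq'
        rw [Nat.not_odd_iff_even] at hq'
        have := (hq'.pow_of_ne_zero hk0).two_dvd
        have := Nat.one_le_pow k q (by lia)
        lia
      · intro h
        exact (h.pow.add_one).two_dvd
    simp only [h2, h3, true_and]
    split_ifs <;> ring
  · simp [h2]

/-- For even `k` the factor `q + 1` of `q ^ 2 - 1` supplies the `2`. For odd `k`, `q ^ (2s+1) - 1 =
q (q ^ (2s) - 1) + (q - 1)` shows the quotient has the parity of `(q - 1) / lam`. -/
theorem two_dvd_pow_sub_one_div {q lam k : ℕ} (hlam : lam ∣ q - 1) (hlam0 : 0 < lam)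
    (hq : Odd q) : 2 ∣ (q ^ k - 1) / lam ↔ Even k ∨ 2 ∣ (q - 1) / lam := by
  obtain ⟨w, hw⟩ := hlam
  rw [hw, Nat.mul_div_cancel_left _ hlam0]
  have hq1 : 1 ≤ q := hq.pos
  have key : ∀ s, ∃ Y, q ^ (2 * s) - 1 = lam * (2 * Y) := by
    intro s
    obtain ⟨X, hX⟩ := exists_pow_two_mul_sub_one_eq q s
    obtain ⟨c, hc⟩ := hq.add_one.two_dvd
    refine ⟨w * c * X, ?_⟩
    have := pow_two_mul_sub_one q 1
    rw [mul_one, pow_one] at this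
    rw [hX, this, hw, hc]
    ring
  rcases Nat.even_or_odd' k with ⟨s, rfl | rfl⟩
  · obtain ⟨Y, hY⟩ := key s
    rw [hY, Nat.mul_div_cancel_left _ hlam0]
    simp
  · obtain ⟨Y, hY⟩ := key s
    have h1 := Nat.one_le_pow (2 * s) q hq1
    have e1 : q ^ (2 * s + 1) - 1 = lam * (q * (2 * Y) + w) := by
      have : q ^ (2 * s + 1) - 1 = q * (q ^ (2 * s) - 1) + (q - 1) := by
        zify [h1, hq1, Nat.one_le_pow (2 * s + 1) q hq1]
        ring
      rw [this, hY, hw]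
      ring
    rw [e1, Nat.mul_div_cancel_left _ hlam0]
    have : ¬ Even (2 * s + 1) := by simp
    simp only [this, false_or]
    rw [mul_left_comm, Nat.dvd_add_right (dvd_mul_right 2 _)]

/-- The gcd with the product divides the product of the gcds, and each divides `2`: for `lam`
because `lam ∣ q ^ k - 1`, which differs from `q ^ k + 1` by `2`. -/
theorem gcd_pow_add_one_dvd_four {q lam k v m₀ : ℕ} (hq : 2 ≤ q) (hlam : lam ∣ q - 1)
    (hm₀ : Odd m₀) (hk : ¬ (2 ^ v ∣ k ∧ ¬ 2 ^ (v + 1) ∣ k)) :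
    Nat.gcd (q ^ k + 1) (lam * (q ^ (2 ^ v * m₀) + 1)) ∣ 4 := by
  have h1 : Nat.gcd (q ^ k + 1) (q ^ (2 ^ v * m₀) + 1) ∣ 2 :=
    dvd_two_of_dvd_pow_add_one hm₀ hk (Nat.gcd_dvd_left _ _) (Nat.gcd_dvd_right _ _)
  have h2 : Nat.gcd (q ^ k + 1) lam ∣ 2 := by
    have h3 : Nat.gcd (q ^ k + 1) lam ∣ q ^ k - 1 :=
      (Nat.gcd_dvd_right _ _).trans (dvd_pow_sub_one_of_dvd_sub_one hlam k)
    have h4 := Nat.dvd_sub (Nat.gcd_dvd_left (q ^ k + 1) lam) h3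
    have := Nat.one_le_pow k q (by lia)
    rwa [show q ^ k + 1 - (q ^ k - 1) = 2 by lia] at h4
  exact (Nat.gcd_mul_right_dvd_mul_gcd _ _ _).trans (mul_dvd_mul h2 h1)

theorem eq_of_dvd_four {G : ℕ} (h : G ∣ 4) :
    G = if 4 ∣ G then 4 else if 2 ∣ G then 2 else 1 := by
  have : G ≤ 4 := Nat.le_of_dvd (by norm_num) h
  interval_cases G <;> simp_all

theorem gcd_pow_add_one_eq_one {q lam k v m₀ : ℕ} (hq : 2 ≤ q) (hlam : lam ∣ q - 1)
    (hm₀ : Odd m₀) (hk : ¬ (2 ^ v ∣ k ∧ ¬ 2 ^ (v + 1) ∣ k)) (hqe : Even q) :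
    Nat.gcd (q ^ k + 1) (lam * (q ^ (2 ^ v * m₀) + 1)) = 1 := by
  have ho : ¬ 2 ∣ lam * (q ^ (2 ^ v * m₀) + 1) := by
    rw [← even_iff_two_dvd, Nat.not_even_iff_odd]
    have h1 : Odd (q - 1) := Nat.Even.sub_odd (by lia) hqe odd_one
    obtain ⟨w, hw⟩ := hlam
    rw [hw] at h1
    have hm : 2 ^ v * m₀ ≠ 0 := by have := hm₀.pos; positivity
    exact (Nat.odd_mul.mp h1).1.mul (hqe.pow_of_ne_zero hm).add_one
  rw [eq_of_dvd_four (gcd_pow_add_one_dvd_four hq hlam hm₀ hk), if_neg, if_neg]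
  · exact fun h => ho (h.trans (Nat.gcd_dvd_right _ _))
  · exact fun h => ho ((show 2 ∣ 4 by norm_num).trans (h.trans (Nat.gcd_dvd_right _ _)))

theorem gcd_pow_add_one_eq_ite {q lam k v m₀ : ℕ} (hq : 2 ≤ q) (hlam : lam ∣ q - 1)
    (hm₀ : Odd m₀) (hk : ¬ (2 ^ v ∣ k ∧ ¬ 2 ^ (v + 1) ∣ k)) (hqo : Odd q) :
    Nat.gcd (q ^ k + 1) (lam * (q ^ (2 ^ v * m₀) + 1)) =
      if Odd k ∧ q % 4 = 3 ∧ Even lam then 4 else 2 := by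
  have h2 : 2 ∣ Nat.gcd (q ^ k + 1) (lam * (q ^ (2 ^ v * m₀) + 1)) :=
    Nat.dvd_gcd hqo.pow.add_one.two_dvd (hqo.pow.add_one.two_dvd.mul_left _)
  have hsq : ∀ s, q ^ (2 * s) % 4 = 1 := by
    intro s
    rw [pow_mul, Nat.pow_mod, Nat.pow_mod q 2]
    have : q % 4 = 1 ∨ q % 4 = 3 := by have := Nat.odd_iff.mp hqo; lia
    rcases this with h | h <;> simp [h]
  rw [eq_of_dvd_four (gcd_pow_add_one_dvd_four hq hlam hm₀ hk), if_pos h2]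
  congr 1
  rw [Nat.dvd_gcd_iff, eq_iff_iff]
  rcases Nat.even_or_odd' k with ⟨s, rfl | rfl⟩
  · have h1 := hsq s
    have h3 : ¬ 4 ∣ q ^ (2 * s) + 1 := by lia
    have h4 : ¬ Odd (2 * s) := by simp
    simp only [h3, h4, false_and]
  -- An odd `k` has exactly `v` factors `2` when `v = 0`, so `hk` rules that out; then `m` is even
  -- and `q ^ m + 1` is `2` modulo `4`.
  · have hv : v ≠ 0 := by
      rintro rfl
      refine hk ⟨by simp, ?_⟩
      lia
    have h4 : Odd (2 * s + 1) := ⟨s, rfl⟩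
    have hm : (q ^ (2 ^ v * m₀) + 1) % 4 = 2 := by
      obtain ⟨w, rfl⟩ := Nat.exists_eq_succ_of_ne_zero hv
      have := hsq (2 ^ w * m₀)
      rw [Nat.pow_succ', mul_assoc]
      lia
    have h5 : 4 ∣ lam * (q ^ (2 ^ v * m₀) + 1) ↔ Even lam := by
      rw [Nat.dvd_iff_mod_eq_zero, Nat.mul_mod, hm, Nat.even_iff]
      have : lam % 4 < 4 := Nat.mod_lt _ (by norm_num)
      interval_cases h : lam % 4 <;> lia
    have h6 : 4 ∣ q ^ (2 * s + 1) + 1 ↔ q % 4 = 3 := by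
      rw [Nat.dvd_iff_mod_eq_zero, pow_succ, Nat.add_mod, Nat.mul_mod, hsq s]
      lia
    rw [h5, h6]
    simp [h4]

/-! ### Summing the gcds over k < 2m -/

theorem sum_range_mul_ite_dvd {R : Type*} [AddCommMonoid R] (a b : ℕ) (ha : 0 < a) (f : ℕ → R) :
    ∑ k ∈ range (a * b), (if a ∣ k then f k else 0) = ∑ j ∈ range b, f (a * j) := by
  rw [← sum_filter]
  refine (sum_bij (fun j _ => a * j) ?_ ?_ ?_ ?_).symm
  · intro j hj
    simp only [mem_filter, mem_range] at hj ⊢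
    exact ⟨Nat.mul_lt_mul_of_pos_left hj ha, dvd_mul_right _ _⟩
  · intro i _ j _ h
    exact Nat.eq_of_mul_eq_mul_left ha h
  · intro k hk
    simp only [mem_filter, mem_range] at hk
    obtain ⟨hk, j, rfl⟩ := hk
    exact ⟨j, mem_range.mpr (Nat.lt_of_mul_lt_mul_left hk), rfl⟩
  · intros; rfl

theorem sum_range_two_mul_ite_even (m : ℕ) (a b : ℚ) :
    ∑ k ∈ range (2 * m), (if Even k then a else b) = m * (a + b) := by
  induction m with
  | zero => simp
  | succ m ih =>
    rw [show 2 * (m + 1) = 2 * m + 1 + 1 by ring, sum_range_succ, sum_range_succ, ih]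
    have : ¬ Even (2 * m + 1) := by simp
    rw [if_pos (even_two_mul m), if_neg this]
    push_cast
    ring

/-- The full range is two periods of `gcd(·, N)`; the even indices account for one of them because
`2` is prime to `N`, so the odd indices account for the other. -/
theorem sum_range_two_mul_ite_odd_gcd {N : ℕ} (hN : Odd N) (h : ℕ → ℚ) :
    ∑ i ∈ range (2 * N), (if ¬ 2 ∣ i then h (Nat.gcd i N) else 0) =
      ∑ j ∈ range N, h (Nat.gcd j N) := by
  have h1 : ∑ i ∈ range (2 * N), h (Nat.gcd i N) = 2 * ∑ j ∈ range N, h (Nat.gcd j N) := by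
    rw [two_mul N, sum_range_add, two_mul]
    simp
  have h2 : ∑ i ∈ range (2 * N), (if 2 ∣ i then h (Nat.gcd i N) else 0) =
      ∑ j ∈ range N, h (Nat.gcd j N) := by
    rw [sum_range_mul_ite_dvd 2 N two_pos]
    refine sum_congr rfl fun j _ => ?_
    rw [Nat.Coprime.gcd_mul_left_cancel _ (Nat.coprime_two_left.mpr hN)]
  have h3 : ∑ i ∈ range (2 * N), (if 2 ∣ i then h (Nat.gcd i N) else 0) +
      ∑ i ∈ range (2 * N), (if ¬ 2 ∣ i then h (Nat.gcd i N) else 0) =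
      ∑ i ∈ range (2 * N), h (Nat.gcd i N) := by
    rw [← sum_add_distrib]
    refine sum_congr rfl fun i _ => ?_
    split_ifs <;> simp_all
  linarith

/-- Each gcd is its generic value (`a`, `b` or `c`, `d` by the parity of `k`) plus a correction
supported on the special `k`. Special `k` for `q ^ k - 1` are even, with generic value `a`; those
for `q ^ k + 1` are odd precisely when `v = 0`, whence the choice between `d` and `c`. -/
theorem sum_gcd_eq {q lam v m₀ : ℕ} (hq : 2 ≤ q) (hlam : lam ∣ q - 1) (hm₀ : Odd m₀)
    (a b c d : ℚ)
    (hsub : ∀ k, ¬ 2 ^ (v + 1) ∣ k →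
      (Nat.gcd (q ^ k - 1) (lam * (q ^ (2 ^ v * m₀) + 1)) : ℚ) = if Even k then a else b)
    (hadd : ∀ k, ¬ (2 ^ v ∣ k ∧ ¬ 2 ^ (v + 1) ∣ k) →
      (Nat.gcd (q ^ k + 1) (lam * (q ^ (2 ^ v * m₀) + 1)) : ℚ) = if Even k then c else d) :
    ∑ k ∈ range (2 * (2 ^ v * m₀)),
        ((Nat.gcd (q ^ k - 1) (lam * (q ^ (2 ^ v * m₀) + 1)) : ℚ) +
          Nat.gcd (q ^ k + 1) (lam * (q ^ (2 ^ v * m₀) + 1))) =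
      2 ^ v * m₀ * (a + b + c + d) - m₀ * a - m₀ * (if v = 0 then d else c) +
        (lam + 1) * (∑ j ∈ range m₀, (q : ℚ) ^ (2 ^ v * Nat.gcd j m₀) + m₀) := by
  set e : ℚ := if v = 0 then d else c with he
  have h1 : ∀ k, (Nat.gcd (q ^ k - 1) (lam * (q ^ (2 ^ v * m₀) + 1)) : ℚ) =
      (if Even k then a else b) + if 2 ^ (v + 1) ∣ k then
        ((Nat.gcd (q ^ k - 1) (lam * (q ^ (2 ^ v * m₀) + 1)) : ℚ) - a) else 0 := by
    intro k
    split_ifs with h2 h3 h3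
    · ring
    · rw [hsub k h3, if_pos h2]; ring
    · exact absurd (((dvd_pow_self 2 (Nat.succ_ne_zero v)).trans h3)) (by
        rwa [← even_iff_two_dvd])
    · rw [hsub k h3, if_neg h2]; ring
  have h2 : ∀ k, (Nat.gcd (q ^ k + 1) (lam * (q ^ (2 ^ v * m₀) + 1)) : ℚ) =
      (if Even k then c else d) + if 2 ^ v ∣ k then (if ¬ 2 ^ (v + 1) ∣ k then
        ((Nat.gcd (q ^ k + 1) (lam * (q ^ (2 ^ v * m₀) + 1)) : ℚ) - e) else 0) else 0 := by
    intro k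
    by_cases hk : 2 ^ v ∣ k ∧ ¬ 2 ^ (v + 1) ∣ k
    · rw [if_pos hk.1, if_pos hk.2]
      have : (if Even k then c else d) = e := by
        rw [he]
        rcases Nat.eq_zero_or_pos v with rfl | hv
        · have : ¬ Even k := by
            rw [even_iff_two_dvd]
            simpa using hk.2
          simp [this]
        · have : Even k := by
            rw [even_iff_two_dvd]
            exact (dvd_pow_self 2 hv.ne').trans hk.1
          simp [this, hv.ne']
      rw [this]; ring
    · rw [hadd k hk]
      split_ifs <;> simp_all
  have h3 : ∑ k ∈ range (2 * (2 ^ v * m₀)), (if 2 ^ (v + 1) ∣ k then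
        ((Nat.gcd (q ^ k - 1) (lam * (q ^ (2 ^ v * m₀) + 1)) : ℚ) - a) else 0) =
      lam * (∑ j ∈ range m₀, (q : ℚ) ^ (2 ^ v * Nat.gcd j m₀) + m₀) - m₀ * a := by
    rw [show 2 * (2 ^ v * m₀) = 2 ^ (v + 1) * m₀ by ring,
      sum_range_mul_ite_dvd _ _ (by positivity)]
    simp_rw [gcd_pow_sub_one_mul_pow_add_one hq hlam hm₀]
    push_cast
    simp_rw [pow_mul]
    rw [sum_sub_distrib, ← mul_sum, sum_add_distrib]
    simp
  have h4 : ∑ k ∈ range (2 * (2 ^ v * m₀)), (if 2 ^ v ∣ k then (if ¬ 2 ^ (v + 1) ∣ k then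
        ((Nat.gcd (q ^ k + 1) (lam * (q ^ (2 ^ v * m₀) + 1)) : ℚ) - e) else 0) else 0) =
      (∑ j ∈ range m₀, (q : ℚ) ^ (2 ^ v * Nat.gcd j m₀) + m₀) - m₀ * e := by
    rw [show 2 * (2 ^ v * m₀) = 2 ^ v * (2 * m₀) by ring,
      sum_range_mul_ite_dvd _ _ (by positivity)]
    have h5 := sum_range_two_mul_ite_odd_gcd hm₀ (fun g => ((q : ℚ) ^ (2 ^ v * g) + 1 - e))
    rw [sum_sub_distrib, sum_add_distrib] at h5
    simp only [sum_const, card_range, nsmul_eq_mul, mul_one] at h5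
    rw [← h5]
    refine sum_congr rfl fun i _ => ?_
    have hi : 2 ^ (v + 1) ∣ 2 ^ v * i ↔ 2 ∣ i := by
      rw [pow_succ]
      exact Nat.mul_dvd_mul_iff_left (by positivity)
    simp only [hi]
    split_ifs with h6
    · rfl
    · rw [gcd_pow_add_one_mul_pow_add_one hq hlam
        (Nat.not_even_iff_odd.mp (by rwa [even_iff_two_dvd])) hm₀]
      push_cast
      rw [pow_mul]
  have h5 := sum_range_two_mul_ite_even (2 ^ v * m₀) a b
  have h6 := sum_range_two_mul_ite_even (2 ^ v * m₀) c d
  rw [sum_congr rfl fun k _ => congrArg₂ (· + ·) (h1 k) (h2 k)]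
  rw [sum_add_distrib, sum_add_distrib, sum_add_distrib, h3, h4, h5, h6]
  push_cast
  ring

/-! ### Möbius inversion and the closed formulas -/

theorem sum_divisors_moebiusSum {q s N : ℕ} (hN : 0 < N) :
    ∑ τ ∈ N.divisors, moebiusSum q s τ = (q : ℚ) ^ (s * N) := by
  refine (ArithmeticFunction.sum_eq_iff_sum_mul_moebius_eq (f := moebiusSum q s)
    (g := fun n => (q : ℚ) ^ (s * n))).mpr ?_ N hN
  intro n hn
  rw [Nat.sum_divisorsAntidiagonal
    (fun x y => ((ArithmeticFunction.moebius x : ℤ) : ℚ) * (q : ℚ) ^ (s * y)), moebiusSum]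
  refine sum_congr rfl fun x hx => ?_
  rw [Nat.mul_div_assoc _ (Nat.dvd_of_mem_divisors hx)]

/-- Expand each power over the divisors of the gcd and swap the sums: `τ` divides `N / τ` of the
indices below `N`. -/
theorem sum_range_pow_gcd {q s N : ℕ} (hN : 0 < N) :
    ∑ j ∈ range N, (q : ℚ) ^ (s * Nat.gcd j N) =
      N * ∑ τ ∈ N.divisors, 1 / (τ : ℚ) * moebiusSum q s τ := by
  have h1 : ∀ j ∈ range N, (q : ℚ) ^ (s * Nat.gcd j N) =
      ∑ τ ∈ N.divisors, if τ ∣ j then moebiusSum q s τ else 0 := by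
    intro j _
    rw [← sum_divisors_moebiusSum (Nat.gcd_pos_of_pos_right j hN), ← sum_filter]
    refine sum_congr ?_ fun _ _ => rfl
    ext τ
    simp only [Nat.mem_divisors, mem_filter, Nat.dvd_gcd_iff]
    have := (Nat.gcd_pos_of_pos_right j hN).ne'
    have := hN.ne'
    tauto
  rw [sum_congr rfl h1, sum_comm, mul_sum]
  refine sum_congr rfl fun τ hτ => ?_
  obtain ⟨c, rfl⟩ := Nat.dvd_of_mem_divisors hτ
  have hτ0 : 0 < τ := Nat.pos_of_mem_divisors hτ
  rw [sum_range_mul_ite_dvd _ _ hτ0 (fun _ => moebiusSum q s τ)]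
  simp only [sum_const, card_range, nsmul_eq_mul]
  push_cast
  field_simp

theorem sum_divisors_filter_moebiusSum {q s N : ℕ} (hN : 0 < N) (C D : ℚ) :
    ∑ τ ∈ N.divisors with 1 < τ, C / (D * τ) * moebiusSum q s τ =
      C / D * (∑ τ ∈ N.divisors, 1 / (τ : ℚ) * moebiusSum q s τ - (q : ℚ) ^ s) := by
  have h1 : (N.divisors.filter fun τ => 1 < τ) = N.divisors.erase 1 := by
    ext τ
    simp only [mem_filter, mem_erase]
    have : τ ∈ N.divisors → 0 < τ := Nat.pos_of_mem_divisors
    grind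
  have h2 : 1 ∈ N.divisors := Nat.one_mem_divisors.mpr hN.ne'
  have h3 : moebiusSum q s 1 = (q : ℚ) ^ s := by simp [moebiusSum]
  rw [h1, ← add_sum_erase _ _ h2, h3]
  simp only [Nat.cast_one, div_one, one_mul, add_sub_cancel_left]
  rw [mul_sum]
  refine sum_congr rfl fun τ _ => ?_
  rw [← mul_assoc, div_mul_div_comm, mul_one]

theorem sum_gcd_eq' {q lam v m₀ : ℕ} {N : ℚ} (hq : 2 ≤ q) (hlam : lam ∣ q - 1) (hm₀ : Odd m₀)
    (a b c d : ℚ)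
    (hN : 4 * (2 ^ v * m₀ : ℕ) * N = ∑ k ∈ range (2 * (2 ^ v * m₀)),
        ((Nat.gcd (q ^ k - 1) (lam * (q ^ (2 ^ v * m₀) + 1)) : ℚ) +
          Nat.gcd (q ^ k + 1) (lam * (q ^ (2 ^ v * m₀) + 1))))
    (hsub : ∀ k, ¬ 2 ^ (v + 1) ∣ k →
      (Nat.gcd (q ^ k - 1) (lam * (q ^ (2 ^ v * m₀) + 1)) : ℚ) = if Even k then a else b)
    (hadd : ∀ k, ¬ (2 ^ v ∣ k ∧ ¬ 2 ^ (v + 1) ∣ k) →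
      (Nat.gcd (q ^ k + 1) (lam * (q ^ (2 ^ v * m₀) + 1)) : ℚ) = if Even k then c else d) :
    N = (a + b + c + d) / 4 + (-a - (if v = 0 then d else c) +
      (lam + 1) * (∑ τ ∈ m₀.divisors, 1 / (τ : ℚ) * moebiusSum q (2 ^ v) τ + 1)) /
        2 ^ (v + 2) := by
  rw [sum_gcd_eq hq hlam hm₀ a b c d hsub hadd, sum_range_pow_gcd hm₀.pos] at hN
  have hm : (m₀ : ℚ) ≠ 0 := by exact_mod_cast hm₀.pos.ne'
  set S := ∑ τ ∈ m₀.divisors, 1 / (τ : ℚ) * moebiusSum q (2 ^ v) τ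
  push_cast at hN
  have h2 : (2 : ℚ) ^ v ≠ 0 := by positivity
  have : (m₀ : ℚ) * (4 * 2 ^ v * N) = m₀ * (2 ^ v * (a + b + c + d) - a -
      (if v = 0 then d else c) + (lam + 1) * (S + 1)) := by linear_combination hN
  have := mul_left_cancel₀ hm this
  rw [pow_add]
  field_simp
  linear_combination 4 * this

theorem card_formulas {q lam v m₀ : ℕ} {N : ℚ} (hq : 2 ≤ q) (hlam : lam ∣ q - 1) (hm₀ : Odd m₀)
    (hN : 4 * (2 ^ v * m₀ : ℕ) * N = ∑ k ∈ range (2 * (2 ^ v * m₀)),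
        ((Nat.gcd (q ^ k - 1) (lam * (q ^ (2 ^ v * m₀) + 1)) : ℚ) +
          Nat.gcd (q ^ k + 1) (lam * (q ^ (2 ^ v * m₀) + 1)))) :
    (Nat.gcd 2 ((q - 1) / lam) = 1 → Odd q → v = 0 →
      N = ((lam : ℚ) * (q + 2) + q + 3) / 4 +
          ∑ τ ∈ m₀.divisors with 1 < τ,
            ((lam : ℚ) + 1) / (4 * τ) * moebiusSum q 1 τ) ∧
    (Nat.gcd 2 ((q - 1) / lam) = 1 → Odd q → v ≠ 0 → q % 4 = 1 →
      N = (3 * (lam : ℚ) + 4) / 4 + ((lam : ℚ) + 1) / 2 ^ (v + 2) * ((q : ℚ) ^ 2 ^ v - 1) +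
          ∑ τ ∈ m₀.divisors with 1 < τ,
            ((lam : ℚ) + 1) / (2 ^ (v + 2) * τ) * moebiusSum q (2 ^ v) τ) ∧
    (Nat.gcd 2 ((q - 1) / lam) = 1 → Odd q → v ≠ 0 → q % 4 = 3 →
      N = 3 * ((lam : ℚ) + 2) / 4 + ((lam : ℚ) + 1) / 2 ^ (v + 2) * ((q : ℚ) ^ 2 ^ v - 1) +
          ∑ τ ∈ m₀.divisors with 1 < τ,
            ((lam : ℚ) + 1) / (2 ^ (v + 2) * τ) * moebiusSum q (2 ^ v) τ) ∧
    (Nat.gcd 2 ((q - 1) / lam) = 2 → Odd q → v = 0 →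
      N = ((lam : ℚ) + 1) * (q + 3) / 4 +
          ∑ τ ∈ m₀.divisors with 1 < τ,
            ((lam : ℚ) + 1) / (4 * τ) * moebiusSum q 1 τ) ∧
    (Nat.gcd 2 ((q - 1) / lam) = 2 → Odd q → v ≠ 0 →
      N = (lam : ℚ) + 1 + ((lam : ℚ) + 1) / 2 ^ (v + 2) * ((q : ℚ) ^ 2 ^ v - 1) +
          ∑ τ ∈ m₀.divisors with 1 < τ,
            ((lam : ℚ) + 1) / (2 ^ (v + 2) * τ) * moebiusSum q (2 ^ v) τ) ∧
    (Even q →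
      N = ((lam : ℚ) + 1) / 2 +
          ∑ τ ∈ m₀.divisors,
            ((lam : ℚ) + 1) / (2 ^ (v + 2) * τ) * moebiusSum q (2 ^ v) τ) := by
  have hlam0 : 0 < lam := Nat.pos_of_dvd_of_pos hlam (by lia)
  have hq1 : (q - 1) / lam * lam = q - 1 := Nat.div_mul_cancel hlam
  have hpar : Nat.gcd 2 ((q - 1) / lam) = 2 ↔ 2 ∣ (q - 1) / lam :=
    Nat.gcd_eq_left_iff_dvd
  have hodd : Odd q → N = (3 * lam + 4 +
      (if Nat.gcd 2 ((q - 1) / lam) = 2 then (lam : ℚ) else 0) +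
      (if q % 4 = 3 ∧ Even lam then 2 else 0)) / 4 +
      (-2 * lam - (if v = 0 then if q % 4 = 3 ∧ Even lam then 4 else 2 else 2) +
        (lam + 1) * (∑ τ ∈ m₀.divisors, 1 / (τ : ℚ) * moebiusSum q (2 ^ v) τ + 1)) /
          2 ^ (v + 2) := by
    intro hqo
    -- For odd `q` the generic gcds with `q ^ k - 1` are `lam` or `2 * lam`, those with `q ^ k + 1`
    -- are `2` or `4`; the undecided values occur only at odd `k`.
    refine (sum_gcd_eq' hq hlam hm₀ (2 * lam)
      (if Nat.gcd 2 ((q - 1) / lam) = 2 then 2 * lam else lam) 2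
      (if q % 4 = 3 ∧ Even lam then 4 else 2) hN ?_ ?_).trans ?_
    · intro k hk
      rw [gcd_pow_sub_one_eq_ite hq hlam hk]
      simp only [two_dvd_pow_sub_one_div hlam hlam0 hqo, hpar]
      by_cases hk2 : Even k <;> by_cases h : 2 ∣ (q - 1) / lam <;> simp [hk2, h, hqo]
    · intro k hk
      rw [gcd_pow_add_one_eq_ite hq hlam hm₀ hk hqo]
      simp only [← Nat.not_even_iff_odd]
      by_cases hk2 : Even k <;> by_cases h : q % 4 = 3 ∧ Even lam <;> simp [hk2, h]
    · split_ifs <;> ring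
  -- Here `q - 1` is `2` modulo `4`, so exactly one of `lam` and `(q - 1) / lam` is even.
  have h4 : q % 4 = 3 → (Even lam ↔ ¬ 2 ∣ (q - 1) / lam) := by
    intro h
    have h1 : (q - 1) % 4 = 2 := by lia
    rw [← hq1, Nat.mul_mod] at h1
    generalize (q - 1) / lam = w at *
    rw [Nat.even_iff]
    have := Nat.mod_lt w (show 4 > 0 by norm_num)
    have := Nat.mod_lt lam (show 4 > 0 by norm_num)
    interval_cases hw : w % 4 <;> interval_cases hl : lam % 4 <;> lia
  refine ⟨?_, ?_, ?_, ?_, ?_, ?_⟩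
  · rintro h hqo rfl
    rw [hodd hqo, sum_divisors_filter_moebiusSum hm₀.pos, h]
    norm_num
    -- For `v = 0` the value `2` or `4` enters with weights `1/4` and `-1/4`, so the residue of `q`
    -- modulo `4` drops out.
    split_ifs <;> ring
  · intro h hqo hv hq4
    rw [hodd hqo, sum_divisors_filter_moebiusSum hm₀.pos, h]
    simp only [hv, hq4, if_false]
    norm_num
    ring
  · intro h hqo hv hq4
    have : Even lam := by rw [h4 hq4, ← hpar]; lia
    rw [hodd hqo, sum_divisors_filter_moebiusSum hm₀.pos, h]
    simp only [hv, hq4, this, if_false]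
    norm_num
    ring
  · rintro h hqo rfl
    rw [hodd hqo, sum_divisors_filter_moebiusSum hm₀.pos, h]
    norm_num
    split_ifs <;> ring
  · intro h hqo hv
    have : ¬ (q % 4 = 3 ∧ Even lam) := by
      rintro ⟨h5, h6⟩
      exact (h4 h5).mp h6 (hpar.mp h)
    rw [hodd hqo, sum_divisors_filter_moebiusSum hm₀.pos, h]
    simp only [hv, this, if_false, if_true]
    ring
  · intro hqe
    refine (sum_gcd_eq' hq hlam hm₀ lam lam 1 1 hN ?_ ?_).trans ?_
    · intro k hk
      rw [gcd_pow_sub_one_eq_ite hq hlam hk]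
      simp [Nat.not_odd_iff_even.mpr hqe]
    · intro k hk
      rw [gcd_pow_add_one_eq_one hq hlam hm₀ hk hqe]
      simp
    · have : ∀ τ ∈ m₀.divisors, ((lam : ℚ) + 1) / (2 ^ (v + 2) * τ) * moebiusSum q (2 ^ v) τ =
          (lam + 1) / 2 ^ (v + 2) * (1 / (τ : ℚ) * moebiusSum q (2 ^ v) τ) := by
        intro τ _
        rw [← mul_assoc, div_mul_div_comm, mul_one]
      rw [sum_congr rfl this, ← mul_sum, ite_self]
      ring

/-! ### Coset leaders and signed cosets -/

/-- The equivalence relation on `ZMod n` whose classes are the sets `C_γ ∪ C_{-γ}`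
when `q` is invertible modulo `n`. -/
def signedCosetSetoid (q n : ℕ) : Setoid (ZMod n) where
  r x y := ∃ s t : ℕ, x * (q : ZMod n) ^ s = y * (q : ZMod n) ^ t ∨
    x * (q : ZMod n) ^ s = -(y * (q : ZMod n) ^ t)
  iseqv :=
    { refl := fun x => ⟨0, 0, Or.inl rfl⟩
      symm := by
        rintro x y ⟨s, t, h | h⟩
        · exact ⟨t, s, Or.inl h.symm⟩
        · exact ⟨t, s, Or.inr (by rw [h, neg_neg])⟩
      trans := by
        rintro x y z ⟨s, t, h⟩ ⟨s', t', h'⟩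
        refine ⟨s + s', t + t', ?_⟩
        rcases h with h | h <;> rcases h' with h' | h'
        · left
          rw [pow_add, pow_add]
          linear_combination (q : ZMod n) ^ s' * h + (q : ZMod n) ^ t * h'
        · right
          rw [pow_add, pow_add]
          linear_combination (q : ZMod n) ^ s' * h + (q : ZMod n) ^ t * h'
        · right
          rw [pow_add, pow_add]
          linear_combination (q : ZMod n) ^ s' * h - (q : ZMod n) ^ t * h'
        · left
          rw [pow_add, pow_add]
          linear_combination (q : ZMod n) ^ s' * h - (q : ZMod n) ^ t * h' }

theorem exists_pow_mul_pow_eq_one {q n : ℕ} (hq : IsOfFinOrder (q : ZMod n)) (t : ℕ) :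
    ∃ s : ℕ, (q : ZMod n) ^ t * (q : ZMod n) ^ s = 1 := by
  obtain ⟨N, hN, hq⟩ := isOfFinOrder_iff_pow_eq_one.mp hq
  obtain ⟨c, rfl⟩ := Nat.exists_eq_succ_of_ne_zero hN.ne'
  refine ⟨c * t, ?_⟩
  rw [← pow_add, show t + c * t = (c + 1) * t by ring, pow_mul, hq, one_pow]

theorem signedCosetSetoid_iff {q n : ℕ} (hq : IsOfFinOrder (q : ZMod n)) {x y : ZMod n} :
    signedCosetSetoid q n x y ↔ ∃ t : ℕ, y = x * (q : ZMod n) ^ t ∨ y = -(x * (q : ZMod n) ^ t) := by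
  constructor
  · rintro ⟨s, t, h⟩
    obtain ⟨u, hu⟩ := exists_pow_mul_pow_eq_one hq t
    refine ⟨s + u, ?_⟩
    rw [pow_add]
    rcases h with h | h
    · left; linear_combination -y * hu - (q : ZMod n) ^ u * h
    · right; linear_combination -y * hu + (q : ZMod n) ^ u * h
  · rintro ⟨t, rfl | rfl⟩
    · exact ⟨t, 0, Or.inl (by simp)⟩
    · exact ⟨t, 0, Or.inr (by simp)⟩

theorem self_mem_cyclotomicCoset (q n : ℕ) (x : ZMod n) : x ∈ cyclotomicCoset q n x :=
  ⟨0, by simp⟩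

theorem cyclotomicCoset_subset {q n : ℕ} {x y : ZMod n} (h : y ∈ cyclotomicCoset q n x) :
    cyclotomicCoset q n y ⊆ cyclotomicCoset q n x := by
  obtain ⟨s, rfl⟩ := h
  rintro _ ⟨t, rfl⟩
  exact ⟨s + t, by rw [pow_add, mul_assoc]⟩

theorem mem_cyclotomicCoset_symm {q n : ℕ} (hq : IsOfFinOrder (q : ZMod n)) {x y : ZMod n}
    (h : y ∈ cyclotomicCoset q n x) : x ∈ cyclotomicCoset q n y := by
  obtain ⟨s, rfl⟩ := h
  obtain ⟨t, ht⟩ := exists_pow_mul_pow_eq_one hq s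
  exact ⟨t, by rw [mul_assoc, ht, mul_one]⟩

theorem cyclotomicCoset_eq {q n : ℕ} (hq : IsOfFinOrder (q : ZMod n)) {x y : ZMod n}
    (h : y ∈ cyclotomicCoset q n x) : cyclotomicCoset q n y = cyclotomicCoset q n x :=
  (cyclotomicCoset_subset h).antisymm (cyclotomicCoset_subset (mem_cyclotomicCoset_symm hq h))

theorem neg_mem_cyclotomicCoset {q n : ℕ} {x y : ZMod n}
    (h : y ∈ cyclotomicCoset q n x) : -y ∈ cyclotomicCoset q n (-x) := by
  obtain ⟨s, rfl⟩ := h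
  exact ⟨s, by ring⟩

theorem exists_val_eq_cosetLeader (q n : ℕ) (x : ZMod n) :
    ∃ y ∈ cyclotomicCoset q n x, y.val = cosetLeader q n x :=
  Nat.sInf_mem (⟨x.val, x, self_mem_cyclotomicCoset q n x, rfl⟩ :
    (ZMod.val '' cyclotomicCoset q n x).Nonempty)

theorem cosetLeader_mem (q n : ℕ) [NeZero n] (x : ZMod n) :
    (cosetLeader q n x : ZMod n) ∈ cyclotomicCoset q n x := by
  obtain ⟨y, hy, h⟩ := exists_val_eq_cosetLeader q n x
  rwa [← h, ZMod.natCast_zmod_val]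

theorem cosetLeader_lt (q n : ℕ) [NeZero n] (x : ZMod n) : cosetLeader q n x < n := by
  obtain ⟨y, _, h⟩ := exists_val_eq_cosetLeader q n x
  rw [← h]
  exact y.val_lt

theorem cosetLeader_eq_of_mem {q n : ℕ} (hq : IsOfFinOrder (q : ZMod n)) {x y : ZMod n}
    (h : y ∈ cyclotomicCoset q n x) : cosetLeader q n y = cosetLeader q n x := by
  rw [cosetLeader, cosetLeader, cyclotomicCoset_eq hq h]

theorem cosetLeader_eq_iff {q n : ℕ} [NeZero n] (hq : IsOfFinOrder (q : ZMod n)) {x y : ZMod n} :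
    cosetLeader q n y = cosetLeader q n x ↔ y ∈ cyclotomicCoset q n x := by
  refine ⟨fun h => ?_, cosetLeader_eq_of_mem hq⟩
  have h1 := cosetLeader_mem q n x
  rw [← h] at h1
  exact cyclotomicCoset_subset h1 (mem_cyclotomicCoset_symm hq (cosetLeader_mem q n y))

theorem cosetLeader_cosetLeader {q n : ℕ} [NeZero n] (hq : IsOfFinOrder (q : ZMod n))
    (x : ZMod n) : cosetLeader q n (cosetLeader q n x : ZMod n) = cosetLeader q n x :=
  cosetLeader_eq_of_mem hq (cosetLeader_mem q n x)

theorem cosetLeader_neg_cosetLeader {q n : ℕ} [NeZero n] (hq : IsOfFinOrder (q : ZMod n))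
    (x : ZMod n) : cosetLeader q n (-(cosetLeader q n x : ZMod n)) = cosetLeader q n (-x) :=
  cosetLeader_eq_of_mem hq (neg_mem_cyclotomicCoset (cosetLeader_mem q n x))

theorem natCast_sub_cosetLeader (q n : ℕ) [NeZero n] (x : ZMod n) :
    ((n - cosetLeader q n x : ℕ) : ZMod n) = -(cosetLeader q n x : ZMod n) := by
  rw [Nat.cast_sub (cosetLeader_lt q n x).le, ZMod.natCast_self, zero_sub]

/-- Negation pairs the cosets, and from each pair of distinct cosets the larger leader is removed.
What survives is the smaller leader of each pair, or the only one when the coset is its own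
negative. -/
theorem leaderSetPi_eq_range {q n : ℕ} [NeZero n] (hq : IsOfFinOrder (q : ZMod n)) :
    leaderSetPi q n = Set.range fun x : ZMod n => min (cosetLeader q n x) (cosetLeader q n (-x)) := by
  ext k
  constructor
  · rintro ⟨⟨x, rfl⟩, hx⟩
    refine ⟨x, min_eq_left ?_⟩
    by_contra! hlt
    refine hx ⟨cosetLeader q n (-x), ⟨-x, rfl⟩, ?_, ?_⟩
    · rw [natCast_sub_cosetLeader, ← cosetLeader_eq_iff hq, cosetLeader_neg_cosetLeader hq,
        cosetLeader_cosetLeader hq, neg_neg]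
      exact hlt.ne'
    · rw [natCast_sub_cosetLeader, cosetLeader_neg_cosetLeader hq, neg_neg, max_eq_right hlt.le]
  · rintro ⟨x, rfl⟩
    wlog hle : cosetLeader q n x ≤ cosetLeader q n (-x) generalizing x
    · have := this (-x) (by rw [neg_neg]; exact (not_le.mp hle).le)
      simp only [neg_neg] at this
      rwa [min_comm] at this
    dsimp only
    rw [min_eq_left hle]
    refine ⟨⟨x, rfl⟩, ?_⟩
    rintro ⟨_, ⟨y, rfl⟩, h1, h2⟩
    rw [natCast_sub_cosetLeader, ← cosetLeader_eq_iff hq, cosetLeader_neg_cosetLeader hq,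
      cosetLeader_cosetLeader hq] at h1
    rw [natCast_sub_cosetLeader, cosetLeader_neg_cosetLeader hq] at h2
    rcases max_choice (cosetLeader q n y) (cosetLeader q n (-y)) with h3 | h3
    · have h4 := h2.trans h3
      have h5 := (cosetLeader_eq_of_mem hq
        (neg_mem_cyclotomicCoset ((cosetLeader_eq_iff hq).mp h4)))
      have := max_eq_left_iff.mp h3
      lia
    · have h4 := h2.trans h3
      have h5 := (cosetLeader_eq_of_mem hq
        (neg_mem_cyclotomicCoset ((cosetLeader_eq_iff hq).mp h4)))
      rw [neg_neg] at h5
      have := max_eq_right_iff.mp h3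
      lia

theorem signedCosetSetoid_iff_cosetLeader {q n : ℕ} [NeZero n] (hq : IsOfFinOrder (q : ZMod n))
    {x y : ZMod n} : signedCosetSetoid q n x y ↔
      cosetLeader q n y = cosetLeader q n x ∨ cosetLeader q n y = cosetLeader q n (-x) := by
  rw [signedCosetSetoid_iff hq, cosetLeader_eq_iff hq, cosetLeader_eq_iff hq, exists_or]
  simp only [cyclotomicCoset, Set.mem_ofPred_eq, neg_mul]

theorem ncard_leaderSetPi {q n : ℕ} [NeZero n] (hq : IsOfFinOrder (q : ZMod n)) :
    (leaderSetPi q n).ncard = Nat.card (Quotient (signedCosetSetoid q n)) := by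
  have key : ∀ x y : ZMod n, signedCosetSetoid q n x y ↔
      min (cosetLeader q n x) (cosetLeader q n (-x)) =
        min (cosetLeader q n y) (cosetLeader q n (-y)) := by
    intro x y
    have h1 : ∀ x y : ZMod n, cosetLeader q n y = cosetLeader q n x →
        cosetLeader q n (-y) = cosetLeader q n (-x) := fun x y h =>
      cosetLeader_eq_of_mem hq (neg_mem_cyclotomicCoset ((cosetLeader_eq_iff hq).mp h))
    rw [signedCosetSetoid_iff_cosetLeader hq]
    have h2 := h1 x y
    have h3 := h1 (-x) y
    have h4 := h1 x (-y)
    have h5 := h1 (-x) (-y)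
    simp only [neg_neg] at h2 h3 h4 h5
    constructor
    · rintro (h | h)
      · rw [h, h2 h]
      · rw [h, h3 h, min_comm]
    · intro h
      rcases min_choice (cosetLeader q n x) (cosetLeader q n (-x)) with h6 | h6 <;>
      rcases min_choice (cosetLeader q n y) (cosetLeader q n (-y)) with h7 | h7 <;>
      rw [h6, h7] at h
      · exact Or.inl h.symm
      · exact Or.inr (h4 h.symm)
      · exact Or.inr h.symm
      · exact Or.inl (h5 h.symm)
  have hinj : Function.Injective (Quotient.lift (s := signedCosetSetoid q n)
      (fun x : ZMod n => min (cosetLeader q n x) (cosetLeader q n (-x)))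
      fun x y h => (key x y).mp h) := by
    intro a b
    induction a using Quotient.inductionOn
    induction b using Quotient.inductionOn
    intro h
    exact Quotient.sound ((key _ _).mpr h)
  rw [← Nat.card_range_of_injective hinj, Set.range_quotient_lift (s := signedCosetSetoid q n), leaderSetPi_eq_range hq,
    Nat.card_coe_set_eq]

/-! ### Burnside count of the signed cosets -/

/-- The action of `ZMod N × {±1}` on `ZMod n` in which `1 : ZMod N` acts as multiplication by an
element `u` with `u ^ N = 1`. -/
@[reducible] def signedPowAction {n N : ℕ} [NeZero N] {u : ZMod n} (hu : u ^ N = 1) :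
    MulAction (Multiplicative (ZMod N) × ℤˣ) (ZMod n) where
  smul g x := ((g.2 : ℤ) : ZMod n) * u ^ (g.1.toAdd.val) * x
  one_smul x := by
    change (((1 : ℤˣ) : ℤ) : ZMod n) * u ^ ((0 : ZMod N).val) * x = x
    simp
  mul_smul g h x := by
    change (((g.2 * h.2 : ℤˣ) : ℤ) : ZMod n) * u ^ ((g.1.toAdd + h.1.toAdd).val) * x =
      ((g.2 : ℤ) : ZMod n) * u ^ (g.1.toAdd.val) * (((h.2 : ℤ) : ZMod n) * u ^ (h.1.toAdd.val) * x)
    rw [ZMod.val_add, ← pow_eq_pow_mod _ hu, pow_add]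
    push_cast
    ring

theorem card_mul_eq_zero (n a : ℕ) [NeZero n] :
    Nat.card {x : ZMod n // (a : ZMod n) * x = 0} = Nat.gcd a n := by
  have h := IsAddCyclic.card_nsmulAddMonoidHom_ker (ZMod n) a
  rw [Nat.card_zmod, Nat.gcd_comm] at h
  rw [← h]
  refine Nat.card_congr (Equiv.subtypeEquivRight fun x => ?_)
  rw [AddMonoidHom.mem_ker]
  simp

theorem sum_val_eq_sum_range (N : ℕ) [NeZero N] (f : ℕ → ℕ) :
    ∑ k : ZMod N, f k.val = ∑ k ∈ range N, f k := by
  obtain ⟨M, rfl⟩ := Nat.exists_eq_succ_of_ne_zero (NeZero.ne N)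
  exact Fin.sum_univ_eq_sum_range f (M + 1)

/-- The points fixed by `(k, 1)` solve `(q ^ k - 1) x = 0` and those fixed by `(k, -1)` solve `(q ^
k + 1) x = 0`. `N` need not be the order of `q`: Burnside's lemma does not ask for a faithful
action. -/
theorem card_signedCosetSetoid {q n N : ℕ} [NeZero n] (hN : 0 < N) (hq0 : 0 < q)
    (hq : (q : ZMod n) ^ N = 1) :
    2 * N * Nat.card (Quotient (signedCosetSetoid q n)) =
      ∑ k ∈ range N, (Nat.gcd (q ^ k - 1) n + Nat.gcd (q ^ k + 1) n) := by
  classical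
  have : NeZero N := ⟨hN.ne'⟩
  let _ := signedPowAction hq
  have hord : IsOfFinOrder (q : ZMod n) := isOfFinOrder_iff_pow_eq_one.mpr ⟨N, hN, hq⟩
  have hs : signedCosetSetoid q n =
      MulAction.orbitRel (Multiplicative (ZMod N) × ℤˣ) (ZMod n) := by
    refine Setoid.ext fun x y => ?_
    rw [Setoid.comm', signedCosetSetoid_iff hord, MulAction.orbitRel_apply]
    constructor
    · rintro ⟨t, h⟩
      have ht : (q : ZMod n) ^ ((t : ZMod N)).val = (q : ZMod n) ^ t := by
        rw [ZMod.val_natCast, ← pow_eq_pow_mod _ hq]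
      rcases h with rfl | rfl
      · refine ⟨(Multiplicative.ofAdd (t : ZMod N), 1), ?_⟩
        change (((1 : ℤˣ) : ℤ) : ZMod n) * (q : ZMod n) ^ ((t : ZMod N)).val * y = _
        rw [ht]
        push_cast
        ring
      · refine ⟨(Multiplicative.ofAdd (t : ZMod N), -1), ?_⟩
        change (((-1 : ℤˣ) : ℤ) : ZMod n) * (q : ZMod n) ^ ((t : ZMod N)).val * y = _
        rw [ht]
        push_cast
        ring
    · rintro ⟨⟨k, e⟩, rfl⟩
      refine ⟨k.toAdd.val, ?_⟩
      change ((e : ℤ) : ZMod n) * (q : ZMod n) ^ k.toAdd.val * y = _ ∨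
        ((e : ℤ) : ZMod n) * (q : ZMod n) ^ k.toAdd.val * y = _
      rcases Int.units_eq_one_or e with rfl | rfl
      · left; push_cast; ring
      · right; push_cast; ring
  have hB := MulAction.sum_card_fixedBy_eq_card_orbits_mul_card_group
    (Multiplicative (ZMod N) × ℤˣ) (ZMod n)
  have hcard : Fintype.card (Multiplicative (ZMod N) × ℤˣ) = 2 * N := by
    rw [Fintype.card_prod, Fintype.card_multiplicative, ZMod.card]
    simp [mul_comm]
  rw [hcard, ← Nat.card_eq_fintype_card] at hB
  rw [hs, mul_comm, ← hB, Fintype.sum_prod_type]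
  have h1 : ∀ k : Multiplicative (ZMod N),
      ∑ e : ℤˣ, Fintype.card (MulAction.fixedBy (ZMod n) (k, e)) =
        Nat.gcd (q ^ k.toAdd.val - 1) n + Nat.gcd (q ^ k.toAdd.val + 1) n := by
    intro k
    rw [show (univ : Finset ℤˣ) = {1, -1} from rfl, sum_pair (by decide)]
    congr 1
    · rw [← card_mul_eq_zero, ← Nat.card_eq_fintype_card]
      refine Nat.card_congr (Equiv.subtypeEquivRight fun x => ?_)
      change (((1 : ℤˣ) : ℤ) : ZMod n) * (q : ZMod n) ^ k.toAdd.val * x = x ↔ _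
      rw [Nat.cast_sub (Nat.one_le_pow _ _ hq0), sub_mul, sub_eq_zero]
      simp
    · rw [← card_mul_eq_zero, ← Nat.card_eq_fintype_card]
      refine Nat.card_congr (Equiv.subtypeEquivRight fun x => ?_)
      change (((-1 : ℤˣ) : ℤ) : ZMod n) * (q : ZMod n) ^ k.toAdd.val * x = x ↔ _
      push_cast
      rw [add_mul, one_mul, neg_one_mul, neg_mul, neg_eq_iff_add_eq_zero]
  rw [sum_congr rfl fun k _ => h1 k]
  rw [← sum_val_eq_sum_range N fun k => Nat.gcd (q ^ k - 1) n + Nat.gcd (q ^ k + 1) n]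
  exact Multiplicative.toAdd.sum_comp fun k : ZMod N =>
    Nat.gcd (q ^ k.val - 1) n + Nat.gcd (q ^ k.val + 1) n

/-! ### Idempotents in algebras with a^q = a -/

theorem natCard_field_eq_of_pow_card_eq {K L : Type*} [Field K] [Fintype K] [Field L] [Finite L]
    [Algebra K L] (h : ∀ a : L, a ^ Fintype.card K = a) : Nat.card L = Fintype.card K := by
  classical
  have := Fintype.ofFinite L
  rw [Nat.card_eq_fintype_card]
  apply le_antisymm
  · have hq : 1 < Fintype.card K := Fintype.one_lt_card
    have h0 := FiniteField.X_pow_card_sub_X_ne_zero L hq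
    have h1 := Polynomial.card_le_degree_of_subset_roots
      (p := (Polynomial.X ^ Fintype.card K - Polynomial.X : Polynomial L))
      (Z := (univ : Finset L)) (by
        intro a _
        rw [Polynomial.mem_roots h0]
        simp [h a])
    rwa [FiniteField.X_pow_card_sub_X_natDegree_eq L hq] at h1
  · exact Fintype.card_le_of_injective _ (algebraMap K L).injective

theorem natCard_isIdempotentElem_field (L : Type*) [Field L] :
    Nat.card {x : L // IsIdempotentElem x} = 2 := by
  simp only [IsIdempotentElem.iff_eq_zero_or_one]
  have : ({x : L | x = 0 ∨ x = 1}).ncard = 2 := Set.ncard_pair zero_ne_one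
  rw [← this, ← Nat.card_coe_set_eq]
  rfl

/-- The identity `a ^ q = a` makes `B` reduced, so the finite ring `B` is the product of its residue
fields. Each has order `q`, so comparing cardinalities gives `r` factors, and each contributes the
idempotents `0` and `1`. -/
theorem natCard_isIdempotentElem_of_pow_card_eq {K B : Type*} [Field K] [Fintype K] [CommRing B]
    [Finite B] [Algebra K B] (h : ∀ a : B, a ^ Fintype.card K = a) {r : ℕ}
    (hr : Nat.card B = Fintype.card K ^ r) :
    Nat.card {e : B // IsIdempotentElem e} = 2 ^ r := by
  classical
  have hq : 1 < Fintype.card K := Fintype.one_lt_card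
  have hred : IsReduced B := by
    rw [isReduced_iff_pow_one_lt _ hq]
    intro x hx
    rw [← h x, hx]
  have := Fintype.ofFinite (MaximalSpectrum B)
  let φ := IsArtinianRing.equivPi B
  have hcard : ∀ I : MaximalSpectrum B, Nat.card (B ⧸ I.asIdeal) = Fintype.card K := by
    intro I
    let _ : Field (B ⧸ I.asIdeal) := Ideal.Quotient.field I.asIdeal
    have : Finite (B ⧸ I.asIdeal) := Finite.of_surjective _ Ideal.Quotient.mk_surjective
    refine natCard_field_eq_of_pow_card_eq (K := K) (L := B ⧸ I.asIdeal) fun a => ?_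
    obtain ⟨b, rfl⟩ := Ideal.Quotient.mk_surjective a
    rw [← map_pow, h b]
  have hidem : ∀ I : MaximalSpectrum B,
      Nat.card {x : B ⧸ I.asIdeal // IsIdempotentElem x} = 2 := by
    intro I
    let _ : Field (B ⧸ I.asIdeal) := Ideal.Quotient.field I.asIdeal
    exact natCard_isIdempotentElem_field (B ⧸ I.asIdeal)
  have h1 : Fintype.card (MaximalSpectrum B) = r := by
    apply Nat.pow_right_injective hq
    change Fintype.card K ^ _ = Fintype.card K ^ _
    rw [← hr, Nat.card_congr φ.toEquiv, Nat.card_pi]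
    simp [hcard]
  have e1 : {e : B // IsIdempotentElem e} ≃
      {f : ∀ I : MaximalSpectrum B, B ⧸ I.asIdeal // ∀ I, IsIdempotentElem (f I)} := by
    refine φ.toEquiv.subtypeEquiv fun e => ?_
    constructor
    · intro he I
      exact congrFun (he.map φ) I
    · intro he
      apply φ.injective
      rw [map_mul]
      exact funext he
  rw [Nat.card_congr (e1.trans Equiv.subtypePiEquivPi), Nat.card_pi]
  rw [prod_congr rfl fun I _ => hidem I, prod_const, card_univ, h1]

/-! ### Frobenius and negation on the group algebra -/

section GroupAlgebra

variable {F : Type*} [Field F] [Fintype F] {n : ℕ}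

theorem frobeniusAlgHom_addMonoidAlgebra :
    FiniteField.frobeniusAlgHom F (AddMonoidAlgebra F (ZMod n)) =
      mapDomainAlgHom F F (AddMonoidHom.mulLeft (Fintype.card F : ZMod n)) := by
  refine AddMonoidAlgebra.algHom_ext (fun m => ?_) (Subsingleton.elim _ _)
  simp [single_pow]

/-- The `q`-th power map is `F`-linear and multiplies indices by `q`, which permutes them when `q`
is a unit. -/
theorem coeff_pow_card (hq : IsUnit (Fintype.card F : ZMod n)) (a : AddMonoidAlgebra F (ZMod n))
    (i : ZMod n) : (a ^ Fintype.card F).coeff ((Fintype.card F : ZMod n) * i) = a.coeff i := by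
  have h := DFunLike.congr_fun (frobeniusAlgHom_addMonoidAlgebra (F := F) (n := n)) a
  rw [FiniteField.coe_frobeniusAlgHom, mapDomainAlgHom_apply] at h
  dsimp only at h
  rw [h, coeff_mapDomain]
  exact Finsupp.mapDomain_apply hq.mul_right_injective _ _

theorem pow_card_pow_eq_self {N : ℕ} (hq : (Fintype.card F : ZMod n) ^ N = 1)
    (a : AddMonoidAlgebra F (ZMod n)) : a ^ Fintype.card F ^ N = a := by
  have h : (FiniteField.frobeniusAlgHom F (AddMonoidAlgebra F (ZMod n))) ^ N =
      AlgHom.id F _ := by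
    refine AddMonoidAlgebra.algHom_ext (fun m => ?_) (Subsingleton.elim _ _)
    rw [AlgHom.coe_pow, FiniteField.coe_frobeniusAlgHom, pow_iterate]
    simp [single_pow, hq]
  have := DFunLike.congr_fun h a
  rwa [AlgHom.coe_pow, FiniteField.coe_frobeniusAlgHom, pow_iterate] at this

/-- The involution of the group algebra of `ZMod n` induced by negation. -/
noncomputable def negAlgEquiv (F : Type*) [Field F] (n : ℕ) :
    AddMonoidAlgebra F (ZMod n) ≃ₐ[F] AddMonoidAlgebra F (ZMod n) :=
  domCongr F F (AddEquiv.neg (ZMod n))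

theorem coeff_negAlgEquiv {F : Type*} [Field F] {n : ℕ} (a : AddMonoidAlgebra F (ZMod n)) (i : ZMod n) :
    (negAlgEquiv F n a).coeff i = a.coeff (-i) := by
  simp [negAlgEquiv]

theorem negAlgEquiv_negAlgEquiv {F : Type*} [Field F] {n : ℕ} (a : AddMonoidAlgebra F (ZMod n)) :
    negAlgEquiv F n (negAlgEquiv F n a) = a := by
  ext i
  simp [coeff_negAlgEquiv]

/-- The elements of the group algebra fixed by Frobenius and by the involution. -/
noncomputable def fixedSubalgebra (F : Type*) [Field F] [Fintype F] (n : ℕ) :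
    Subalgebra F (AddMonoidAlgebra F (ZMod n)) :=
  AlgHom.equalizer (FiniteField.frobeniusAlgHom F (AddMonoidAlgebra F (ZMod n))) (AlgHom.id F _) ⊓
    AlgHom.equalizer (negAlgEquiv F n).toAlgHom (AlgHom.id F _)

theorem mem_fixedSubalgebra {a : AddMonoidAlgebra F (ZMod n)} :
    a ∈ fixedSubalgebra F n ↔ a ^ Fintype.card F = a ∧ negAlgEquiv F n a = a :=
  Iff.rfl

theorem mem_fixedSubalgebra_iff_coeff (hq : IsUnit (Fintype.card F : ZMod n))
    {a : AddMonoidAlgebra F (ZMod n)} : a ∈ fixedSubalgebra F n ↔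
      ∀ i j, signedCosetSetoid (Fintype.card F) n i j → a.coeff i = a.coeff j := by
  rw [mem_fixedSubalgebra]
  constructor
  · rintro ⟨h1, h2⟩
    have h3 : ∀ i, a.coeff (i * (Fintype.card F : ZMod n)) = a.coeff i := by
      intro i
      conv_lhs => rw [← h1, mul_comm]
      exact coeff_pow_card hq a i
    have h4 : ∀ i (t : ℕ), a.coeff (i * (Fintype.card F : ZMod n) ^ t) = a.coeff i := by
      intro i t
      induction t with
      | zero => simp
      | succ t ih => rw [pow_succ, ← mul_assoc, h3, ih]
    have h5 : ∀ i, a.coeff (-i) = a.coeff i := by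
      intro i
      rw [← coeff_negAlgEquiv, h2]
    rintro i j ⟨s, t, h | h⟩
    · rw [← h4 i s, h, h4]
    · rw [← h4 i s, h, h5, h4]
  · intro h
    constructor
    · ext i
      obtain ⟨j, rfl⟩ : ∃ j, (Fintype.card F : ZMod n) * j = i := by
        obtain ⟨u, hu⟩ := hq
        exact ⟨(u⁻¹ : (ZMod n)ˣ) * i, by rw [← hu, Units.mul_inv_cancel_left]⟩
      rw [coeff_pow_card hq]
      exact h _ _ ⟨1, 0, Or.inl (by ring)⟩
    · ext i
      rw [coeff_negAlgEquiv]
      exact h _ _ ⟨0, 0, Or.inr (by simp)⟩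

theorem natCard_fixedSubalgebra [NeZero n] (hq : IsUnit (Fintype.card F : ZMod n)) :
    Nat.card (fixedSubalgebra F n) =
      Fintype.card F ^ Nat.card (Quotient (signedCosetSetoid (Fintype.card F) n)) := by
  let s := signedCosetSetoid (Fintype.card F) n
  let e : fixedSubalgebra F n ≃ (Quotient s → F) :=
    { toFun := fun a => Quotient.lift (fun i => a.1.coeff i)
        ((mem_fixedSubalgebra_iff_coeff hq).mp a.2)
      invFun := fun f => ⟨ofCoeff (Finsupp.equivFunOnFinite.symm fun i => f (Quotient.mk s i)),
        (mem_fixedSubalgebra_iff_coeff hq).mpr fun i j h => by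
          simp only [Finsupp.equivFunOnFinite_symm_apply_apply]
          rw [Quotient.sound h]⟩
      left_inv := fun a => by
        ext i
        simp
      right_inv := fun f => by
        ext i
        induction i using Quotient.inductionOn
        simp }
  rw [Nat.card_congr e, Nat.card_fun, Nat.card_eq_fintype_card (α := F)]

theorem finite_addMonoidAlgebra [NeZero n] : Finite (AddMonoidAlgebra F (ZMod n)) :=
  Module.finite_of_finite F

/-- Idempotents are automatically fixed by Frobenius, so those fixed by the involution are exactly
the idempotents of `fixedSubalgebra`. -/
theorem natCard_isIdempotentElem_negAlgEquiv [NeZero n] (hq : IsUnit (Fintype.card F : ZMod n)) :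
    Nat.card {e : AddMonoidAlgebra F (ZMod n) // IsIdempotentElem e ∧ negAlgEquiv F n e = e} =
      2 ^ Nat.card (Quotient (signedCosetSetoid (Fintype.card F) n)) := by
  have := finite_addMonoidAlgebra (F := F) (n := n)
  rw [← natCard_isIdempotentElem_of_pow_card_eq (K := F) (B := fixedSubalgebra F n)
    (fun a => Subtype.ext (mem_fixedSubalgebra.mp a.2).1) (natCard_fixedSubalgebra hq)]
  refine Nat.card_congr
    { toFun := fun e => ⟨⟨e.1, mem_fixedSubalgebra.mpr
        ⟨e.2.1.pow_eq Fintype.card_ne_zero, e.2.2⟩⟩, Subtype.ext e.2.1⟩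
      invFun := fun e => ⟨e.1.1, congrArg Subtype.val e.2, (mem_fixedSubalgebra.mp e.1.2).2⟩
      left_inv := fun e => rfl
      right_inv := fun e => rfl }

end GroupAlgebra

/-! ### Cyclic codes as ideals generated by idempotents -/

section CyclicCodes

variable {F : Type*} [Field F] {n : ℕ} [NeZero n]

/-- A word of length `n` as an element of the group algebra of `ZMod n`. -/
noncomputable def wordEquiv (F : Type*) [Field F] (n : ℕ) [NeZero n] :
    (Fin n → F) ≃ₗ[F] AddMonoidAlgebra F (ZMod n) :=
  (LinearEquiv.funCongrLeft F F (ZMod.finEquiv n).symm.toEquiv).trans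
    ((Finsupp.linearEquivFunOnFinite F F (ZMod n)).symm.trans
      (coeffLinearEquiv F (S := F) (M := ZMod n)).symm)

theorem coeff_wordEquiv (c : Fin n → F) (i : ZMod n) :
    (wordEquiv F n c).coeff i = c ((ZMod.finEquiv n).symm i) :=
  rfl

theorem coeff_single_one_mul_one {F : Type*} [Field F] {n : ℕ} (i j : ZMod n) (a : AddMonoidAlgebra F (ZMod n)) :
    (single i (1 : F) * a).coeff j = a.coeff (j - i) := by
  rw [coeff_single_mul_eq_mul_coeff (j - i) fun m _ => (eq_sub_iff_add_eq'.symm : _), one_mul]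

theorem wordEquiv_shift (c : Fin n → F) :
    wordEquiv F n (fun i => c ((finRotate n).symm i)) = single 1 1 * wordEquiv F n c := by
  ext i
  rw [coeff_single_one_mul_one, coeff_wordEquiv, coeff_wordEquiv]
  congr 1
  rw [Equiv.symm_apply_eq, finRotate_apply, map_sub, map_one, sub_add_cancel]

theorem coeff_mul_negAlgEquiv_zero (x y : AddMonoidAlgebra F (ZMod n)) :
    (x * negAlgEquiv F n y).coeff 0 = ∑ i, x.coeff i * y.coeff i := by
  classical
  rw [coeff_mul, Finsupp.sum_fintype _ _ (by simp)]
  refine sum_congr rfl fun i _ => ?_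
  rw [Finsupp.sum_fintype _ _ (by simp), sum_eq_single (-i)]
  · simp [coeff_negAlgEquiv]
  · intro j _ hj
    rw [if_neg]
    exact fun h => hj (eq_neg_of_add_eq_zero_right h)
  · simp

theorem coeff_wordEquiv_mul_negAlgEquiv_zero (x y : Fin n → F) :
    (wordEquiv F n x * negAlgEquiv F n (wordEquiv F n y)).coeff 0 = x ⬝ᵥ y := by
  rw [coeff_mul_negAlgEquiv_zero]
  exact (ZMod.finEquiv n).symm.toEquiv.sum_comp fun i => x i * y i

/-- Taking `b = single k 1` moves the coefficient at `k` to the position `0`, so all coefficients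
are tested. -/
theorem mul_negAlgEquiv_eq_zero_iff {F : Type*} [Field F] {n : ℕ} (x e : AddMonoidAlgebra F (ZMod n)) :
    (∀ b, (x * negAlgEquiv F n (e * b)).coeff 0 = 0) ↔ x * negAlgEquiv F n e = 0 := by
  constructor
  · intro h
    ext k
    have h1 := h (single k 1)
    have h2 : negAlgEquiv F n (single k 1) = single (-k) 1 := by simp [negAlgEquiv]
    rw [map_mul, ← mul_assoc, h2, mul_comm, coeff_single_one_mul_one] at h1
    simpa using h1
  · intro h b
    rw [map_mul, ← mul_assoc, h, zero_mul]
    rfl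

/-- The cyclic code generated by an element of the group algebra. -/
noncomputable def cyclicCodeOf (e : AddMonoidAlgebra F (ZMod n)) : Submodule F (Fin n → F) :=
  ((Ideal.span {e}).restrictScalars F).comap (wordEquiv F n).toLinearMap

theorem mem_cyclicCodeOf {e : AddMonoidAlgebra F (ZMod n)} {c : Fin n → F} :
    c ∈ cyclicCodeOf e ↔ ∃ b, wordEquiv F n c = e * b := by
  change wordEquiv F n c ∈ Ideal.span {e} ↔ _
  rw [Ideal.mem_span_singleton]
  rfl

theorem isCyclicCode_cyclicCodeOf (e : AddMonoidAlgebra F (ZMod n)) :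
    IsCyclicCode (cyclicCodeOf e) := by
  intro c hc
  rw [mem_cyclicCodeOf] at hc ⊢
  obtain ⟨b, hb⟩ := hc
  exact ⟨single 1 1 * b, by rw [wordEquiv_shift, hb, mul_left_comm]⟩

theorem mem_dualCode_cyclicCodeOf {e : AddMonoidAlgebra F (ZMod n)} {x : Fin n → F} :
    x ∈ dualCode (cyclicCodeOf e) ↔ wordEquiv F n x * negAlgEquiv F n e = 0 := by
  rw [← mul_negAlgEquiv_eq_zero_iff]
  change (∀ c ∈ cyclicCodeOf e, x ⬝ᵥ c = 0) ↔ _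
  constructor
  · intro h b
    obtain ⟨c, hc⟩ := (wordEquiv F n).surjective (e * b)
    rw [← hc, coeff_wordEquiv_mul_negAlgEquiv_zero]
    exact h c (mem_cyclicCodeOf.mpr ⟨b, hc⟩)
  · intro h c hc
    obtain ⟨b, hb⟩ := mem_cyclicCodeOf.mp hc
    rw [← coeff_wordEquiv_mul_negAlgEquiv_zero, hb]
    exact h b

/-- The dual is the annihilator of `e*`. Hence `e (1 - e*)` lies in both code and dual, and its
vanishing gives `e = e e*`, which is symmetric under the involution. Conversely, if `e* = e`, then
`x = e b` in the dual gives `x = x e = 0`. -/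
theorem isLCDCode_cyclicCodeOf_iff {e : AddMonoidAlgebra F (ZMod n)} (he : IsIdempotentElem e) :
    IsLCDCode (cyclicCodeOf e) ↔ negAlgEquiv F n e = e := by
  have he' : e * e = e := he
  rw [IsLCDCode, Submodule.eq_bot_iff]
  constructor
  · intro h
    obtain ⟨x, hx⟩ := (wordEquiv F n).surjective (e * (1 - negAlgEquiv F n e))
    have h1 : negAlgEquiv F n e * negAlgEquiv F n e = negAlgEquiv F n e := by
      rw [← map_mul, he']
    have hx0 : x = 0 := h x (Submodule.mem_inf.mpr ⟨mem_cyclicCodeOf.mpr ⟨_, hx⟩,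
      mem_dualCode_cyclicCodeOf.mpr (by rw [hx]; linear_combination -e * h1)⟩)
    rw [hx0, map_zero] at hx
    have h2 : e = e * negAlgEquiv F n e := by linear_combination -hx
    have h3 := congrArg (negAlgEquiv F n) h2
    rw [map_mul, negAlgEquiv_negAlgEquiv, mul_comm] at h3
    rw [h3, ← h2]
  · intro h x hx
    obtain ⟨h1, h2⟩ := Submodule.mem_inf.mp hx
    obtain ⟨b, hb⟩ := mem_cyclicCodeOf.mp h1
    rw [mem_dualCode_cyclicCodeOf, h, hb] at h2
    apply (wordEquiv F n).injective
    rw [map_zero, hb, ← h2]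
    linear_combination -b * he'

/-- An idempotent generator acts as the identity on its ideal, so two generators of one ideal
satisfy `e = f e = f`. -/
theorem cyclicCodeOf_injOn : Set.InjOn (cyclicCodeOf (F := F) (n := n))
    {e | IsIdempotentElem e} := by
  have key : ∀ e f : AddMonoidAlgebra F (ZMod n), IsIdempotentElem f →
      cyclicCodeOf e = cyclicCodeOf f → f * e = e := by
    intro e f hf h
    obtain ⟨c, hc⟩ := (wordEquiv F n).surjective e
    have h1 : c ∈ cyclicCodeOf e := mem_cyclicCodeOf.mpr ⟨1, by rw [hc, mul_one]⟩
    rw [h] at h1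
    obtain ⟨b, hb⟩ := mem_cyclicCodeOf.mp h1
    rw [hc] at hb
    have hf' : f * f = f := hf
    rw [hb, ← mul_assoc, hf']
  intro e he f hf h
  rw [← key e f hf h, mul_comm, key f e he h.symm]

theorem single_pow_one (k : ZMod n) : (single 1 1 : AddMonoidAlgebra F (ZMod n)) ^ k.val =
    single k 1 := by
  simp [single_pow]

theorem IsCyclicCode.mul_mem {C : Submodule F (Fin n → F)} (hC : IsCyclicCode C)
    (a b : AddMonoidAlgebra F (ZMod n)) (hb : b ∈ C.map (wordEquiv F n).toLinearMap) :
    a * b ∈ C.map (wordEquiv F n).toLinearMap := by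
  have h1 : ∀ b ∈ C.map (wordEquiv F n).toLinearMap,
      single 1 1 * b ∈ C.map (wordEquiv F n).toLinearMap := by
    rintro _ ⟨c, hc, rfl⟩
    exact ⟨_, hC c hc, wordEquiv_shift c⟩
  have h2 : ∀ k : ℕ, single 1 1 ^ k * b ∈ C.map (wordEquiv F n).toLinearMap := by
    intro k
    induction k with
    | zero => simpa using hb
    | succ k ih =>
      rw [pow_succ', mul_assoc]
      exact h1 _ ih
  induction a using AddMonoidAlgebra.induction_linear with
  | zero => rw [zero_mul]; exact Submodule.zero_mem _
  | add x y hx hy => rw [add_mul]; exact Submodule.add_mem _ hx hy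
  | single k r =>
    have : (single k r : AddMonoidAlgebra F (ZMod n)) = r • single k 1 := by simp
    rw [this, smul_mul_assoc, ← single_pow_one]
    exact Submodule.smul_mem _ _ (h2 _)

/-- Writing `a = a * a ^ (M - 1)` gives `I = I * I`, and a finitely generated idempotent ideal is
generated by an idempotent. -/
theorem Ideal.exists_isIdempotentElem_of_pow_eq_self {R : Type*} [CommRing R] [IsNoetherianRing R]
    {M : ℕ} (hM : 2 ≤ M) (h : ∀ a : R, a ^ M = a) (I : Ideal R) :
    ∃ e, IsIdempotentElem e ∧ I = Ideal.span {e} := by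
  rw [← Ideal.isIdempotentElem_iff_of_fg I (IsNoetherian.noetherian I)]
  refine le_antisymm Ideal.mul_le_left fun a ha => ?_
  rw [← h a, show M = 1 + (M - 2 + 1) by lia, pow_add, pow_one]
  exact Ideal.mul_mem_mul ha (I.pow_mem_of_mem ha _ (by lia))

theorem IsCyclicCode.exists_eq_cyclicCodeOf [Fintype F] {N : ℕ} (hN : 0 < N)
    (hq : (Fintype.card F : ZMod n) ^ N = 1) {C : Submodule F (Fin n → F)}
    (hC : IsCyclicCode C) : ∃ e, IsIdempotentElem e ∧ C = cyclicCodeOf e := by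
  have := finite_addMonoidAlgebra (F := F) (n := n)
  let I : Ideal (AddMonoidAlgebra F (ZMod n)) :=
    { C.map (wordEquiv F n).toLinearMap with smul_mem' := fun a b hb => hC.mul_mem a b hb }
  obtain ⟨e, he, hI⟩ := Ideal.exists_isIdempotentElem_of_pow_eq_self
    (M := Fintype.card F ^ N)
    (Fintype.one_lt_card.trans_le (Nat.le_self_pow hN.ne' _)) (pow_card_pow_eq_self hq) I
  refine ⟨e, he, ?_⟩
  ext c
  change _ ↔ wordEquiv F n c ∈ Ideal.span {e}
  rw [← hI]
  exact ((wordEquiv F n).injective.mem_set_image (s := (C : Set (Fin n → F)))).symm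

theorem ncard_lcdCyclicCodes [Fintype F] {N : ℕ} (hN : 0 < N)
    (hq : (Fintype.card F : ZMod n) ^ N = 1) :
    (lcdCyclicCodes F n).ncard =
      2 ^ Nat.card (Quotient (signedCosetSetoid (Fintype.card F) n)) - 1 := by
  have hunit : IsUnit (Fintype.card F : ZMod n) := IsUnit.of_pow_eq_one hq hN.ne'
  have h1 : {C : Submodule F (Fin n → F) | IsCyclicCode C ∧ IsLCDCode C} =
      cyclicCodeOf '' {e | IsIdempotentElem e ∧ negAlgEquiv F n e = e} := by
    ext C
    constructor
    · rintro ⟨h1, h2⟩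
      obtain ⟨e, he, rfl⟩ := h1.exists_eq_cyclicCodeOf hN hq
      exact ⟨e, ⟨he, (isLCDCode_cyclicCodeOf_iff he).mp h2⟩, rfl⟩
    · rintro ⟨e, ⟨he, h⟩, rfl⟩
      exact ⟨isCyclicCode_cyclicCodeOf e, (isLCDCode_cyclicCodeOf_iff he).mpr h⟩
  have h2 : {C : Submodule F (Fin n → F) | IsCyclicCode C ∧ IsLCDCode C}.ncard =
      2 ^ Nat.card (Quotient (signedCosetSetoid (Fintype.card F) n)) := by
    rw [h1, (cyclicCodeOf_injOn.mono fun e he => he.1).ncard_image,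
      ← natCard_isIdempotentElem_negAlgEquiv hunit, ← Nat.card_coe_set_eq]
    rfl
  have h3 : lcdCyclicCodes F n =
      {C : Submodule F (Fin n → F) | IsCyclicCode C ∧ IsLCDCode C} \ {⊥} := by
    ext C
    simp only [lcdCyclicCodes, Set.mem_sdiff, Set.mem_singleton_iff]
    exact and_comm
  -- The zero code, from the idempotent `0`, is the one subtracted.
  have h4 : (⊥ : Submodule F (Fin n → F)) ∈
      {C : Submodule F (Fin n → F) | IsCyclicCode C ∧ IsLCDCode C} := by
    refine ⟨?_, bot_inf_eq _⟩
    intro c hc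
    rw [Submodule.mem_bot] at hc ⊢
    rw [hc]
    rfl
  rw [h3, Set.ncard_sdiff_singleton_of_mem h4, h2]

end CyclicCodes

/-! ### Conclusion -/

/-- Since `lam` divides `q ^ m - 1`, `n` divides `(q ^ m - 1)(q ^ m + 1)`. This period `2 * m`
serves both Burnside's lemma and the idempotent generators. -/
theorem natCast_pow_two_mul_eq_one {q lam m n : ℕ} (hq : 0 < q) (hlam : lam ∣ q - 1)
    (hn : n = lam * (q ^ m + 1)) : (q : ZMod n) ^ (2 * m) = 1 := by
  apply natCast_pow_eq_one_of_dvd hq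
  rw [hn, pow_two_mul_sub_one, mul_comm]
  exact mul_dvd_mul_left _ (dvd_pow_sub_one_of_dvd_sub_one hlam m)

end

theorem mainTheorem5 {F : Type*} [Field F] [Fintype F] (q lam m v m₀ n : ℕ)
    (hq : Fintype.card F = q) (hlam : lam ∣ q - 1) (hm : 0 < m)
    (hv : m = 2 ^ v * m₀) (hm₀ : ¬ 2 ∣ m₀) (hn : n = lam * (q ^ m + 1)) :
    (lcdCyclicCodes F n).ncard = 2 ^ (leaderSetPi q n).ncard - 1 ∧
    (Nat.gcd 2 ((q - 1) / lam) = 1 → Odd q → Odd m →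
      ((leaderSetPi q n).ncard : ℚ) =
        ((lam : ℚ) * (q + 2) + q + 3) / 4 +
          ∑ τ ∈ m.divisors with 1 < τ,
            ((lam : ℚ) + 1) / (4 * τ) * moebiusSum q 1 τ) ∧
    (Nat.gcd 2 ((q - 1) / lam) = 1 → Odd q → Even m → q % 4 = 1 →
      ((leaderSetPi q n).ncard : ℚ) =
        (3 * (lam : ℚ) + 4) / 4 + ((lam : ℚ) + 1) / 2 ^ (v + 2) * ((q : ℚ) ^ 2 ^ v - 1) +
          ∑ τ ∈ m₀.divisors with 1 < τ,
            ((lam : ℚ) + 1) / (2 ^ (v + 2) * τ) * moebiusSum q (2 ^ v) τ) ∧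
    (Nat.gcd 2 ((q - 1) / lam) = 1 → Odd q → Even m → q % 4 = 3 →
      ((leaderSetPi q n).ncard : ℚ) =
        3 * ((lam : ℚ) + 2) / 4 + ((lam : ℚ) + 1) / 2 ^ (v + 2) * ((q : ℚ) ^ 2 ^ v - 1) +
          ∑ τ ∈ m₀.divisors with 1 < τ,
            ((lam : ℚ) + 1) / (2 ^ (v + 2) * τ) * moebiusSum q (2 ^ v) τ) ∧
    (Nat.gcd 2 ((q - 1) / lam) = 2 → Odd q → Odd m →
      ((leaderSetPi q n).ncard : ℚ) =
        ((lam : ℚ) + 1) * (q + 3) / 4 +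
          ∑ τ ∈ m.divisors with 1 < τ,
            ((lam : ℚ) + 1) / (4 * τ) * moebiusSum q 1 τ) ∧
    (Nat.gcd 2 ((q - 1) / lam) = 2 → Odd q → Even m →
      ((leaderSetPi q n).ncard : ℚ) =
        (lam : ℚ) + 1 + ((lam : ℚ) + 1) / 2 ^ (v + 2) * ((q : ℚ) ^ 2 ^ v - 1) +
          ∑ τ ∈ m₀.divisors with 1 < τ,
            ((lam : ℚ) + 1) / (2 ^ (v + 2) * τ) * moebiusSum q (2 ^ v) τ) ∧
    (Even q →
      ((leaderSetPi q n).ncard : ℚ) =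
        ((lam : ℚ) + 1) / 2 +
          ∑ τ ∈ m₀.divisors,
            ((lam : ℚ) + 1) / (2 ^ (v + 2) * τ) * moebiusSum q (2 ^ v) τ) := by
  have hq2 : 2 ≤ q := hq ▸ Fintype.one_lt_card
  have hm₀' : Odd m₀ := Nat.not_even_iff_odd.mp (by rwa [even_iff_two_dvd])
  have hlam0 : 0 < lam := Nat.pos_of_dvd_of_pos hlam (by lia)
  have hn0 : n ≠ 0 := by rw [hn]; positivity
  have : NeZero n := ⟨hn0⟩
  have hpow := natCast_pow_two_mul_eq_one (by lia) hlam hn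
  have hm2 : 0 < 2 * m := by lia
  have hcard := ncard_leaderSetPi (isOfFinOrder_iff_pow_eq_one.mpr ⟨2 * m, hm2, hpow⟩)
  have hburnside := card_signedCosetSetoid hm2 (by lia : 0 < q) hpow
  refine ⟨?_, ?_⟩
  · rw [hcard, ncard_lcdCyclicCodes hm2 (by rwa [hq]), hq]
  rw [← hcard, hn] at hburnside
  have hvodd : Odd m ↔ v = 0 := by
    rw [hv, Nat.odd_mul]
    refine ⟨fun h => ?_, fun h => ⟨by simp [h], hm₀'⟩⟩
    by_contra hv0
    exact Nat.not_even_iff_odd.mpr h.1 (even_two.pow_of_ne_zero hv0)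
  have hveven : Even m ↔ v ≠ 0 := by rw [← Nat.not_odd_iff_even, hvodd]
  have key := card_formulas (v := v) (m₀ := m₀) (N := ((leaderSetPi q n).ncard : ℚ)) hq2 hlam
    hm₀' (by
      rw [← hv, hn]
      have h := congrArg (Nat.cast : ℕ → ℚ) hburnside
      push_cast at h ⊢
      rw [← h]
      ring)
  obtain ⟨h1, h2, h3, h4, h5, h6⟩ := key
  refine ⟨?_, ?_, ?_, ?_, ?_, h6⟩
  · intro hg hqo hmo
    have hv0 := hvodd.mp hmo
    rw [h1 hg hqo hv0, hv, hv0, pow_zero, one_mul]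
  · intro hg hqo hme
    exact h2 hg hqo (hveven.mp hme)
  · intro hg hqo hme
    exact h3 hg hqo (hveven.mp hme)
  · intro hg hqo hmo
    have hv0 := hvodd.mp hmo
    rw [h4 hg hqo hv0, hv, hv0, pow_zero, one_mul]
  · intro hg hqo hme
    exact h5 hg hqo (hveven.mp hme)
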